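/- Let $\mathbb{K}$ be a field of characteristic zero, let $\Sigma$ be a signature (a set with an arity map $\Sigma\to\mathbb{N}$), and let $T(\Sigma)$ be the free nonsymmetric set operad on $\Sigma$: its elements are the $\Sigma$-terms (planar rooted trees whose internal nodes with $n$ children are decorated by elements of arity $n$), the arity of a term is its number of leaves, the composition $t[t_1,\dots,t_n]$ grafts $t_i$ onto the $i$-th leaf of $t$, and the unit is the leaf. The degree $\deg t$ of a term is its number of internal nodes. Let $\equiv$ be an operad congruence of $T(\Sigma)$ (an arity-preserving equivalence relation compatible with composition) such that $t\equiv t'$ implies $\deg t=\deg t'$ and such that every $\equiv$-class is finite. Let $\mathcal{O}:=T(\Sigma)/{\equiv}$, let $\pi$ be the canonical projection, applied letter by letter to words, and let $\deg$ also denote the induced map on $\mathcal{O}$. For an operad $\mathcal{P}$ with unit $\mathbf{1}$, let $\mathrm{rd}$ be the map deleting the letters $\mathbf{1}$ from words on $\mathcal{P}$. Let $\mathbf{N}(\mathcal{P})$ be the vector space with basis $(E_w)_w$ indexed by the words $w$ on $\mathcal{P}\setminus\{\mathbf{1}\}$, with product $E_wE_{w'}=E_{ww'}$, with counit $E_w\mapsto[w=\epsilon]$,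 and, when every element of $\mathcal{P}$ has finitely many factorizations $x=y[y_1,\dots,y_n]$, with the coproduct $\Delta$ defined as the algebra morphism such that, for $x\neq\mathbf{1}$, $$\Delta(E_x)=\sum_{x=y[y_1,\dots,y_n]}E_{\mathrm{rd}(y)}\otimes E_{\mathrm{rd}(y_1\cdots y_n)}.$$ Given a map $\deg:\mathcal{P}\to\mathbb{N}$, the degree of $E_w$ is the sum of the degrees of the letters of $w$. A $\Sigma$-forest-like alphabet is a set $A$ endowed with a unary relation $R^A$, a unary relation $D_s^A$ for each $s\in\Sigma$, and a binary relation $\to_j^A$ for each $j\ge1$, with no condition. The disjoint sum $A_1+\!\!\!+A_2$ is the set $A_1\sqcup A_2$ with $R:=R^{A_1}\sqcup R^{A_2}$, $D_s:=D_s^{A_1}\sqcup D_s^{A_2}$, and $a\to_j a'$ if and only if $a,a'\in A_1$ and $a\to_j^{A_1}a'$, or $a,a'\in A_2$ and $a\to_j^{A_2}a'$, or $a\in A_1$, $a'\in A_2$ and $a'\in R^{A_2}$. The alphabet of positions $A_p(\Sigma)$ is the set of letters $a^s_u$ with $s\in\Sigma$ and $u\in\mathbb{N}^*$, where $R$ consists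 of the letters $a^s_{0^\ell}$ with $\ell\ge0$, $D_s$ consists of the letters $a^s_u$, and $a^s_u\to_j a^{s'}_{v}$ if and only if $v=u\,j\,0^\ell$ for some $\ell\ge0$. Let $\mathbb{K}\langle A\rangle$ be the graded algebra of noncommutative polynomials on $A$ with possibly infinite support and finite degree. For a word $f$ of terms different from the leaf (a reduced forest), number its internal nodes $1,\dots,\deg f$ in left-to-right preorder. A word $w\in A^*$ is compatible with $f$ if its length is $\deg f$, $w_i\in R^A$ for each root $i$, $w_i\in D^A_s$ for each internal node $i$ decorated by $s$, and $w_i\to_j^A w_{i'}$ whenever the internal node $i'$ is the $j$-th child of the internal node $i$. Let $r_A:\mathbf{N}(T(\Sigma))\to\mathbb{K}\langle A\rangle$ be the linear map sending $E_f$ to the sum of all words compatible with $f$, let $\varphi:\mathbf{N}(\mathcal{O})\to\mathbf{N}(T(\Sigma))$ be the linear map sending $E_x$ to $\sum_{f:\,\pi(f)=x}E_f$, the sum being over reduced forests, and let $\bar r_A:=r_A\circ\varphi$. Let $\theta_{A_1,A_2}$ be the linear map on $\mathbb{K}\langle A_1\sqcup A_2\rangle$, compatible with infinite sums, sending each word $w$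 to $w_{|A_1}\otimes w_{|A_2}$; its values are possibly infinite linear combinations of the tensors $u\otimes v$ with $u\in A_1^*$ and $v\in A_2^*$, a space that contains $\mathbb{K}\langle A_1\rangle\otimes\mathbb{K}\langle A_2\rangle$. Then every element of $\mathcal{O}$ has finitely many factorizations, the map $\deg$ is a grading of $\mathcal{O}$ (it vanishes exactly on the unit, and $\deg(y[y_1,\dots,y_n])=\deg y+\sum_i\deg y_i$), $\mathbf{N}(\mathcal{O})$ is a Hopf algebra, and the class of $\Sigma$-forest-like alphabets, the operation $+\!\!\!+$, the maps $\bar r_A$ and the alphabet $A_p(\Sigma)$ form a polynomial realization of $\mathbf{N}(\mathcal{O})$, that is: 1. $+\!\!\!+$ is associative (up to the canonical bijection) and is the disjoint sum on the underlying sets; 2. for every $\Sigma$-forest-like alphabet $A$, $\bar r_A$ is a graded unital associative algebra morphism; 3. for all $\Sigma$-forest-like alphabets $A_1,A_2$ and all $x\in\mathbf{N}(\mathcal{O})$, $\theta_{A_1,A_2}(\bar r_{A_1+\!\!\!+A_2}(x))=(\bar r_{A_1}\otimes\bar r_{A_2})(\Delta(x))$; 4. $\bar r_{A_p(\Sigma)}$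 is injective. -/

import Mathlib

open scoped TensorProduct

universe u v

noncomputable section

namespace NatHopf

/-! ### Signatures and nonsymmetric operads -/

/-- A signature: a set endowed with an arity map. -/
structure Signature where
  carrier : Type u
  arity : carrier → ℕ

/-- A signature without elements of arity zero. -/
def Signature.Positive (S : Signature.{u}) : Prop := ∀ s, 1 ≤ S.arity s

/-- A nonsymmetric set operad, presented by its full composition maps. The arguments of an
`(m₁ + ⋯ + mₙ)`-ary element are grouped in `n` consecutive blocks by `finSigmaFinEquiv`. -/
structure Operad extends Signature.{u} where
  unit : carrier
  arity_unit : arity unit = 1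
  comp : (x : carrier) → (Fin (arity x) → carrier) → carrier
  arity_comp : ∀ x y, arity (comp x y) = ∑ i, arity (y i)
  unit_comp : ∀ x, comp unit (fun _ => x) = x
  comp_unit : ∀ x, comp x (fun _ => unit) = x
  comp_assoc : ∀ (x : carrier) (y : Fin (arity x) → carrier)
    (z : Fin (arity (comp x y)) → carrier),
    comp (comp x y) z = comp x (fun i => comp (y i)
      (fun j => z (Fin.cast (arity_comp x y).symm (finSigmaFinEquiv ⟨i, j⟩))))

namespace Operad

/-- Every element has finitely many factorizations `x = y[y₁, …, yₙ]`. -/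
def FinitelyFactorizable (O : Operad.{u}) : Prop :=
  ∀ x : O.carrier,
    {p : (y : O.carrier) × (Fin (O.arity y) → O.carrier) | O.comp p.1 p.2 = x}.Finite

/-- `deg` is a grading of the operad `O`. -/
structure IsGrading (O : Operad.{u}) (deg : O.carrier → ℕ) : Prop where
  eq_zero_iff : ∀ x, deg x = 0 ↔ x = O.unit
  comp : ∀ x y, deg (O.comp x y) = deg x + ∑ i, deg (y i)

/-- An operad congruence: an equivalence relation that preserves the arity and is compatible
with the composition. -/
structure Congruence (O : Operad.{u}) where
  setoid : Setoid O.carrier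
  arity_eq : ∀ {x x'}, setoid x x' → O.arity x = O.arity x'
  comp : ∀ {x x'} (y : Fin (O.arity x) → O.carrier) (y' : Fin (O.arity x') → O.carrier),
    setoid x x' → (∀ i i', i.val = i'.val → setoid (y i) (y' i')) →
    setoid (O.comp x y) (O.comp x' y')

namespace Congruence

variable {O : Operad.{u}} (c : O.Congruence)

/-- Underlying set of the quotient operad. -/
def Carrier : Type u := Quotient c.setoid

/-- The canonical projection. -/
def proj (x : O.carrier) : c.Carrier := Quotient.mk c.setoid x

/-- A chosen representative of an equivalence class. -/
def rep (x : c.Carrier) : O.carrier := Quotient.out x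

theorem proj_rep (x : c.Carrier) : c.proj (c.rep x) = x := Quotient.out_eq x

theorem proj_eq_iff {x y : O.carrier} : c.proj x = c.proj y ↔ c.setoid x y := Quotient.eq

/-- Arity of an equivalence class. -/
def quotArity (x : c.Carrier) : ℕ := Quotient.lift O.arity (fun _ _ h => c.arity_eq h) x

theorem arity_rep (x : c.Carrier) : O.arity (c.rep x) = c.quotArity x := by
  conv_rhs => rw [← c.proj_rep x]
  rfl

/-- Composition of equivalence classes; it does not depend on the representatives, see
`quotComp_proj`. -/
def quotComp (x : c.Carrier) (y : Fin (c.quotArity x) → c.Carrier) : c.Carrier :=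
  c.proj (O.comp (c.rep x) (fun i => c.rep (y (Fin.cast (c.arity_rep x) i))))

theorem quotComp_proj (x : O.carrier) (y : Fin (O.arity x) → O.carrier) :
    c.quotComp (c.proj x) (fun i => c.proj (y i)) = c.proj (O.comp x y) := by
  refine c.proj_eq_iff.2 (c.comp _ _ (c.proj_eq_iff.1 (c.proj_rep _)) fun i i' h => ?_)
  rw [← c.proj_eq_iff, c.proj_rep]
  exact congrArg (fun k => c.proj (y k)) (Fin.ext h)

theorem exists_proj (x : c.Carrier) (y : Fin (c.quotArity x) → c.Carrier) :
    ∃ (x' : O.carrier) (y' : Fin (O.arity x') → O.carrier) (h : c.proj x' = x),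
      ∀ i, y i = c.proj (y' (Fin.cast (by rw [← h]; rfl) i)) := by
  refine ⟨c.rep x, fun i => c.rep (y (Fin.cast (c.arity_rep x) i)), c.proj_rep x, fun i => ?_⟩
  rw [c.proj_rep]
  rfl

theorem quotArity_comp (x : c.Carrier) (y : Fin (c.quotArity x) → c.Carrier) :
    c.quotArity (c.quotComp x y) = ∑ i, c.quotArity (y i) := by
  obtain ⟨x, y', rfl, h⟩ := c.exists_proj x y
  obtain rfl : y = fun i => c.proj (y' i) := funext h
  exact (congrArg c.quotArity (c.quotComp_proj x y')).trans (O.arity_comp x y')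

/-- The quotient operad. -/
def quotient : Operad.{u} where
  carrier := c.Carrier
  arity := c.quotArity
  unit := c.proj O.unit
  arity_unit := O.arity_unit
  comp := c.quotComp
  arity_comp := c.quotArity_comp
  unit_comp x := by
    rw [← c.proj_rep x, c.quotComp_proj O.unit (fun _ => c.rep x), O.unit_comp]
  comp_unit x := by
    obtain ⟨x, rfl⟩ : ∃ x', c.proj x' = x := ⟨_, c.proj_rep x⟩
    rw [c.quotComp_proj x (fun _ => O.unit), O.comp_unit]
  comp_assoc x y z := by
    obtain ⟨x, y', rfl, h⟩ := c.exists_proj x y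
    obtain rfl : y = fun i => c.proj (y' i) := funext h
    have key : ∀ (q : c.Carrier) (z : Fin (c.quotArity q) → c.Carrier) (hq : c.proj (O.comp x y') = q),
        c.quotComp q z = c.proj (O.comp (O.comp x y')
          (fun k => c.rep (z (Fin.cast (by rw [← hq]; rfl) k)))) := by
      rintro q z rfl
      exact (congrArg (c.quotComp (c.proj (O.comp x y')))
        (funext fun k => (c.proj_rep (z k)).symm)).trans (c.quotComp_proj _ _)
    refine (key _ z (c.quotComp_proj x y').symm).trans ?_
    refine (congrArg c.proj (O.comp_assoc x y' _)).trans ?_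
    refine (c.quotComp_proj x _).symm.trans (congrArg (c.quotComp (c.proj x)) (funext fun i => ?_))
    refine (c.quotComp_proj (y' i) _).symm.trans
      (congrArg (c.quotComp (c.proj (y' i))) (funext fun j => ?_))
    exact c.proj_rep _

end Congruence

end Operad

/-! ### Terms and free operads -/

/-- Terms on a signature: planar rooted trees whose internal nodes with `n` children are
decorated by elements of arity `n`. -/
inductive STerm (S : Signature.{u}) : Type u
  | leaf : STerm S
  | node (s : S.carrier) (t : Fin (S.arity s) → STerm S) : STerm S

namespace STerm

variable {S : Signature.{u}}

/-- Number of internal nodes. -/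
def degree : STerm S → ℕ
  | leaf => 0
  | node _ t => 1 + ∑ i, (t i).degree

/-- Number of leaves. -/
def arity : STerm S → ℕ
  | leaf => 1
  | node _ t => ∑ i, (t i).arity

/-- `t.graft w` is obtained by grafting the root of `w i` onto the `i`-th leaf of `t`. -/
def graft : (t : STerm S) → (Fin t.arity → STerm S) → STerm S
  | leaf, w => w (0 : Fin 1)
  | node s t, w => node s (fun i => (t i).graft (fun k => w (finSigmaFinEquiv ⟨i, k⟩)))

theorem arity_graft : ∀ (t : STerm S) (w : Fin t.arity → STerm S),
    (t.graft w).arity = ∑ i, (w i).arity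
  | leaf, w => (Fin.sum_univ_one (fun i : Fin 1 => (w i).arity)).symm
  | node s t, w => by
    change ∑ i, ((t i).graft _).arity = ∑ k : Fin (∑ i, (t i).arity), (w k).arity
    rw [← finSigmaFinEquiv.sum_comp, Fintype.sum_sigma]
    exact Finset.sum_congr rfl fun i _ => arity_graft (t i) _

theorem leaf_graft (t : STerm S) : (leaf : STerm S).graft (fun _ => t) = t := rfl

theorem graft_leaf : ∀ t : STerm S, t.graft (fun _ => leaf) = t
  | leaf => rfl
  | node s t => congrArg (node s) (funext fun i => graft_leaf (t i))

theorem sum_range_blocks (N F : ℕ → ℕ) (m : ℕ) :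
    ∑ l ∈ Finset.range (∑ i ∈ Finset.range m, N i), F l =
      ∑ i ∈ Finset.range m, ∑ k ∈ Finset.range (N i), F (∑ i' ∈ Finset.range i, N i' + k) := by
  induction m with
  | zero => simp
  | succ m ih => rw [Finset.sum_range_succ, Finset.sum_range_add, ih, Finset.sum_range_succ]

theorem finSigmaFinEquiv_assoc {m : ℕ} {n : Fin m → ℕ} (a : Fin (∑ i, n i) → ℕ)
    (b : Fin m → ℕ) (hb : ∀ i, b i = ∑ k, a (finSigmaFinEquiv ⟨i, k⟩))
    (i : Fin m) (k : Fin (n i)) (j : Fin (a (finSigmaFinEquiv ⟨i, k⟩))) :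
    (finSigmaFinEquiv (n := b) ⟨i, Fin.cast (hb i).symm
      (finSigmaFinEquiv (n := fun k => a (finSigmaFinEquiv ⟨i, k⟩)) ⟨k, j⟩)⟩ : ℕ) =
      (finSigmaFinEquiv (n := a) ⟨finSigmaFinEquiv ⟨i, k⟩, j⟩ : ℕ) := by
  let N : ℕ → ℕ := fun x => if h : x < m then n ⟨x, h⟩ else 0
  let F : ℕ → ℕ := fun x => if h : x < ∑ i, n i then a ⟨x, h⟩ else 0
  have hN : ∀ x : Fin m, N x = n x := fun x => by simp [N]
  have hF : ∀ x : Fin (∑ i, n i), F x = a x := fun x => by simp [F]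
  have hoff : ∀ (x : Fin m) (y : Fin (n x)),
      (finSigmaFinEquiv (n := n) ⟨x, y⟩ : ℕ) = ∑ i' ∈ Finset.range x, N i' + y := by
    intro x y
    rw [finSigmaFinEquiv_apply, Finset.sum_range]
    congr 1
    exact Finset.sum_congr rfl fun z _ => (hN (Fin.castLE x.2.le z)).symm
  have hb' : ∀ x : Fin m, b x = ∑ y ∈ Finset.range (N x), F (∑ i' ∈ Finset.range x, N i' + y) := by
    intro x
    rw [hb, hN, Finset.sum_range]
    refine Finset.sum_congr rfl fun y _ => ?_
    rw [← hoff, hF]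
  rw [finSigmaFinEquiv_apply, finSigmaFinEquiv_apply]
  simp only [Fin.val_cast]
  rw [finSigmaFinEquiv_apply, ← add_assoc]
  congr 1
  have h1 : ∑ x : Fin (i : ℕ), b (Fin.castLE i.2.le x) =
      ∑ x ∈ Finset.range i, ∑ y ∈ Finset.range (N x), F (∑ i' ∈ Finset.range x, N i' + y) := by
    rw [Finset.sum_range]
    exact Finset.sum_congr rfl fun x _ => hb' (Fin.castLE i.2.le x)
  have h2 : ∑ y : Fin (k : ℕ), a (finSigmaFinEquiv ⟨i, Fin.castLE k.2.le y⟩) =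
      ∑ y ∈ Finset.range k, F (∑ i' ∈ Finset.range i, N i' + y) := by
    rw [Finset.sum_range]
    refine Finset.sum_congr rfl fun y _ => ?_
    rw [← hF, hoff]
    rfl
  have h3 : ∑ l : Fin (finSigmaFinEquiv (n := n) ⟨i, k⟩ : ℕ),
      a (Fin.castLE (finSigmaFinEquiv (n := n) ⟨i, k⟩).2.le l) =
      ∑ l ∈ Finset.range (∑ i' ∈ Finset.range i, N i' + k), F l := by
    rw [← hoff, Finset.sum_range]
    exact Finset.sum_congr rfl fun l _ => (hF _).symm
  exact (congrArg₂ (· + ·) h1 h2).trans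
    ((by rw [Finset.sum_range_add, sum_range_blocks] :
      ∑ l ∈ Finset.range (∑ i' ∈ Finset.range i, N i' + k), F l = _).symm.trans h3.symm)

theorem graft_assoc : ∀ (t : STerm S) (y : Fin t.arity → STerm S)
    (z : Fin (t.graft y).arity → STerm S),
    (t.graft y).graft z = t.graft (fun i => (y i).graft
      (fun j => z (Fin.cast (arity_graft t y).symm (finSigmaFinEquiv ⟨i, j⟩))))
  | leaf, y, z => by
    change (y (0 : Fin 1)).graft z = (y (0 : Fin 1)).graft _
    congr 1
    funext j
    congr 1
    exact Fin.ext (finSigmaFinEquiv_one (n := fun i : Fin 1 => (y i).arity) ⟨0, j⟩).symm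
  | node s t, y, z => by
    refine congrArg (node s) (funext fun i => ?_)
    rw [graft_assoc (t i)]
    congr 1
    funext k
    congr 1
    funext j
    congr 1
    exact Fin.ext (finSigmaFinEquiv_assoc (n := fun i => (t i).arity) (fun l => (y l).arity)
      _ (fun i => arity_graft (t i) _) i k j)

end STerm

/-- The free operad on a signature. -/
def freeOperad (S : Signature.{u}) : Operad.{u} where
  carrier := STerm S
  arity := STerm.arity
  unit := STerm.leaf
  arity_unit := rfl
  comp := STerm.graft
  arity_comp := STerm.arity_graft
  unit_comp := STerm.leaf_graft
  comp_unit := STerm.graft_leaf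
  comp_assoc := STerm.graft_assoc

namespace Operad.Congruence

variable {S : Signature.{u}} (c : (freeOperad S).Congruence)

/-- Congruent terms have the same degree. -/
def DegreeCompatible : Prop := ∀ t t' : STerm S, c.setoid t t' → t.degree = t'.degree

/-- Every equivalence class is finite. -/
def FiniteType : Prop := ∀ t : STerm S, {t' : STerm S | c.setoid t' t}.Finite

/-- The degree of an equivalence class of terms. -/
def quotDegree (h : c.DegreeCompatible) : c.quotient.carrier → ℕ :=
  Quotient.lift STerm.degree h

end Operad.Congruence

/-! ### Natural Hopf algebras -/

/-- The elements of an operad different from the unit. -/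
abbrev Operad.NonUnit (O : Operad.{u}) : Type u := {x : O.carrier // x ≠ O.unit}

/-- Reduced words on an operad: words on its elements different from the unit. -/
abbrev Operad.RWord (O : Operad.{u}) : Type u := FreeMonoid O.NonUnit

open scoped Classical in
/-- The reduced word obtained from `w` by removing its letters equal to the unit. -/
def Operad.rd (O : Operad.{u}) (w : List O.carrier) : O.RWord :=
  FreeMonoid.ofList (w.filterMap fun x => if h : x ≠ O.unit then some ⟨x, h⟩ else none)

/-- A reduced word seen as a word on the operad. -/
def Operad.RWord.word {O : Operad.{u}} (w : O.RWord) : List O.carrier :=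
  (FreeMonoid.toList w).map Subtype.val

section

variable (K : Type v) [Field K] (O : Operad.{u})

/-- The algebra `N(O)`: the linear span of reduced words, with concatenation as product. -/
abbrev NatAlg : Type (max u v) := MonoidAlgebra K O.RWord

variable {O} in
/-- The elementary basis. -/
def elem (w : O.RWord) : NatAlg K O := MonoidAlgebra.single w 1

/-- Linear maps out of `N(O)` defined by their values on the elementary basis. -/
def natLift {M : Type*} [AddCommGroup M] [Module K M] (g : O.RWord → M) : NatAlg K O →ₗ[K] M :=
  Finsupp.linearCombination K g ∘ₗ (MonoidAlgebra.coeffLinearEquiv K).toLinearMap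

/-- The coproduct of `N(O)`: the algebra morphism sending the generator `E_x` to the sum of the
`E_{rd(y)} ⊗ E_{rd(y₁…yₙ)}` over all factorizations `x = y[y₁, …, yₙ]`. The sum is finite as
soon as `O` is finitely factorizable. -/
def comul : NatAlg K O →ₐ[K] NatAlg K O ⊗[K] NatAlg K O :=
  MonoidAlgebra.lift K (NatAlg K O ⊗[K] NatAlg K O) O.RWord (FreeMonoid.lift fun x : O.NonUnit =>
    ∑ᶠ (p : (y : O.carrier) × (Fin (O.arity y) → O.carrier)) (_ : O.comp p.1 p.2 = x.1),
      elem K (O.rd [p.1]) ⊗ₜ[K] elem K (O.rd (List.ofFn p.2)))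

/-- The counit of `N(O)`. -/
def counit : NatAlg K O →ₐ[K] K :=
  MonoidAlgebra.lift K K O.RWord (FreeMonoid.lift fun _ : O.NonUnit => (0 : K))

variable {O} in
/-- The homogeneous component of degree `n` of `N(O)`, for a degree map on `O` extended
additively to words. -/
def natGrading (deg : O.carrier → ℕ) (n : ℕ) : Submodule K (NatAlg K O) :=
  Submodule.span K {x | ∃ w : O.RWord, (w.word.map deg).sum = n ∧ x = elem K w}

end

/-- An algebra `H` together with `Δ` and `ε` is a Hopf algebra. -/
structure IsHopfAlgebra {K : Type*} {H : Type*} [Field K] [Ring H] [Algebra K H]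
    (Δ : H →ₐ[K] H ⊗[K] H) (ε : H →ₐ[K] K) : Prop where
  coassoc : (TensorProduct.assoc K H H H).toLinearMap ∘ₗ Δ.toLinearMap.rTensor H ∘ₗ
    Δ.toLinearMap = Δ.toLinearMap.lTensor H ∘ₗ Δ.toLinearMap
  rTensor_counit : ε.toLinearMap.rTensor H ∘ₗ Δ.toLinearMap = TensorProduct.mk K K H 1
  lTensor_counit : ε.toLinearMap.lTensor H ∘ₗ Δ.toLinearMap = (TensorProduct.mk K H K).flip 1
  antipode : ∃ σ : H →ₗ[K] H,
    LinearMap.mul' K H ∘ₗ σ.rTensor H ∘ₗ Δ.toLinearMap =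
      Algebra.linearMap K H ∘ₗ ε.toLinearMap ∧
    LinearMap.mul' K H ∘ₗ σ.lTensor H ∘ₗ Δ.toLinearMap =
      Algebra.linearMap K H ∘ₗ ε.toLinearMap

/-! ### Noncommutative polynomials with possibly infinite support and finite degree -/

/-- The functions on words that vanish on all words of large enough length. -/
def polySubmodule (K : Type v) [Field K] (A : Type u) : Submodule K (List A → K) where
  carrier := {f | ∃ n, ∀ w : List A, n < w.length → f w = 0}
  zero_mem' := ⟨0, fun _ _ => rfl⟩
  add_mem' := by
    rintro f g ⟨n, hn⟩ ⟨m, hm⟩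
    refine ⟨max n m, fun w hw => ?_⟩
    rw [Pi.add_apply, hn w (by omega), hm w (by omega), add_zero]
  smul_mem' := by
    rintro a f ⟨n, hn⟩
    refine ⟨n, fun w hw => ?_⟩
    rw [Pi.smul_apply, hn w hw, smul_zero]

/-- The space of `A`-polynomials; `f.1 w` is the coefficient of the word `w`. -/
abbrev Poly (K : Type v) [Field K] (A : Type u) : Type (max u v) := polySubmodule K A

namespace Poly

variable {K : Type v} [Field K] {A : Type u}

/-- Convolution of functions on words with respect to concatenation. -/
def conv (f g : List A → K) (w : List A) : K :=
  ∑ i ∈ Finset.range (w.length + 1), f (w.take i) * g (w.drop i)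

theorem conv_nil (f g : List A → K) : conv f g [] = f [] * g [] := by simp [conv]

theorem conv_cons (f g : List A → K) (a : A) (w : List A) :
    conv f g (a :: w) = f [] * g (a :: w) + conv (fun v => f (a :: v)) g w := by
  rw [conv, List.length_cons, Finset.sum_range_succ', add_comm]
  simp [conv]

theorem conv_add_left (f f' g : List A → K) (w : List A) :
    conv (fun v => f v + f' v) g w = conv f g w + conv f' g w := by
  simp [conv, add_mul, Finset.sum_add_distrib]

theorem conv_add_right (f g g' : List A → K) (w : List A) :
    conv f (fun v => g v + g' v) w = conv f g w + conv f g' w := by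
  simp [conv, mul_add, Finset.sum_add_distrib]

theorem conv_smul_left (r : K) (f g : List A → K) (w : List A) :
    conv (fun v => r * f v) g w = r * conv f g w := by
  simp [conv, Finset.mul_sum, mul_assoc]

theorem conv_smul_right (r : K) (f g : List A → K) (w : List A) :
    conv f (fun v => r * g v) w = r * conv f g w := by
  simp [conv, Finset.mul_sum, mul_left_comm]

theorem zero_conv (g : List A → K) (w : List A) : conv (fun _ => 0) g w = 0 := by
  simp [conv]

theorem conv_zero (f : List A → K) (w : List A) : conv f (fun _ => 0) w = 0 := by
  simp [conv]

theorem conv_assoc (f g h : List A → K) (w : List A) :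
    conv (conv f g) h w = conv f (conv g h) w := by
  induction w generalizing f g with
  | nil => simp [conv_nil, mul_assoc]
  | cons a w ih =>
    simp only [conv_cons, conv_nil, conv_add_left, conv_smul_left]
    rw [ih]
    ring

/-- The polynomial `1`, that is, the empty word. -/
def delta : List A → K
  | [] => 1
  | _ :: _ => 0

theorem delta_conv (f : List A → K) (w : List A) : conv delta f w = f w := by
  cases w with
  | nil => simp [conv_nil, delta]
  | cons a w =>
    rw [conv_cons]
    simp only [delta, conv, zero_mul, Finset.sum_const_zero, one_mul, add_zero]

theorem conv_delta (f : List A → K) (w : List A) : conv f delta w = f w := by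
  induction w generalizing f with
  | nil => simp [conv_nil, delta]
  | cons a w ih => simp [conv_cons, delta, ih]

instance : One (Poly K A) :=
  ⟨⟨delta, 0, fun w hw => by cases w with
    | nil => simp at hw
    | cons a w => rfl⟩⟩

instance : Mul (Poly K A) :=
  ⟨fun f g => ⟨conv f.1 g.1, by
    obtain ⟨n, hn⟩ := f.2
    obtain ⟨m, hm⟩ := g.2
    refine ⟨n + m, fun w hw => Finset.sum_eq_zero fun i _ => ?_⟩
    by_cases h : n < (w.take i).length
    · rw [hn _ h, zero_mul]
    · rw [hm _ (by simp only [List.length_take, List.length_drop] at *; omega), mul_zero]⟩⟩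

instance : Ring (Poly K A) :=
  { Submodule.addCommGroup (polySubmodule K A) with
    mul := (· * ·)
    one := 1
    mul_assoc := fun f g h => Subtype.ext (funext (conv_assoc f.1 g.1 h.1))
    one_mul := fun f => Subtype.ext (funext (delta_conv f.1))
    mul_one := fun f => Subtype.ext (funext (conv_delta f.1))
    left_distrib := fun f g h => Subtype.ext (funext (conv_add_right f.1 g.1 h.1))
    right_distrib := fun f g h => Subtype.ext (funext (conv_add_left f.1 g.1 h.1))
    zero_mul := fun f => Subtype.ext (funext (zero_conv f.1))
    mul_zero := fun f => Subtype.ext (funext (conv_zero f.1)) }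

instance : Algebra K (Poly K A) :=
  Algebra.ofModule
    (fun r f g => Subtype.ext (funext (conv_smul_left r f.1 g.1)))
    (fun r f g => Subtype.ext (funext (conv_smul_right r f.1 g.1)))

end Poly

section

variable (K : Type v) [Field K]

/-- The homogeneous polynomials of degree `n`. -/
def polyGrading (A : Type u) (n : ℕ) : Submodule K (Poly K A) where
  carrier := {f | ∀ w : List A, w.length ≠ n → f.1 w = 0}
  zero_mem' := fun _ _ => rfl
  add_mem' := by
    intro f g hf hg w hw
    change f.1 w + g.1 w = 0
    rw [hf w hw, hg w hw, add_zero]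
  smul_mem' := by
    intro r f hf w hw
    change r * f.1 w = 0
    rw [hf w hw, mul_zero]

/-- The canonical map sending `f ⊗ g` to the series `∑ f(u) g(v) u ⊗ v` in two sets of
variables. It is injective, see `toPairs_injective`. -/
def toPairs (A B : Type u) : Poly K A ⊗[K] Poly K B →ₗ[K] (List A × List B → K) :=
  TensorProduct.lift (LinearMap.mk₂ K (fun f g p => f.1 p.1 * g.1 p.2)
    (fun f f' g => funext fun p => add_mul (f.1 p.1) (f'.1 p.1) (g.1 p.2))
    (fun r f g => funext fun p => mul_assoc r (f.1 p.1) (g.1 p.2))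
    (fun f g g' => funext fun p => mul_add (f.1 p.1) (g.1 p.2) (g'.1 p.2))
    (fun r f g => funext fun p => mul_left_comm (f.1 p.1) r (g.1 p.2)))

theorem toPairs_injective (A B : Type u) : Function.Injective (toPairs K A B) := by
  classical
  rw [injective_iff_map_eq_zero]
  intro x hx
  let b := Module.Basis.ofVectorSpace K (Poly K A)
  obtain ⟨g, rfl⟩ := (TensorProduct.equivFinsuppOfBasisLeft (N := Poly K B) b).symm.surjective x
  rw [TensorProduct.equivFinsuppOfBasisLeft_symm_apply] at hx ⊢
  have hg : ∀ v : List B, Finsupp.linearCombination K b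
      (g.mapRange (fun p : Poly K B => p.1 v) rfl) = 0 := by
    intro v
    refine Subtype.ext (funext fun w => ?_)
    have h := congrFun hx (w, v)
    rw [Finsupp.sum, map_sum] at h
    rw [Finsupp.linearCombination_apply, Finsupp.sum_mapRange_index (by simp), Finsupp.sum]
    simp only [AddSubmonoidClass.coe_finsetSum, Finset.sum_apply] at h ⊢
    refine Eq.trans (Finset.sum_congr rfl fun i _ => ?_) h
    exact mul_comm ((g i).1 v) ((b i).1 w)
  have : g = 0 := by
    ext i v
    exact DFunLike.congr_fun
      ((linearIndependent_iff.1 b.linearIndependent) _ (hg v)) i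
  rw [this, Finsupp.sum_zero_index]

/-- The subword of `w` made of its letters in the first summand. -/
def leftPart {A B : Type u} (w : List (A ⊕ B)) : List A := w.filterMap Sum.getLeft?

/-- The subword of `w` made of its letters in the second summand. -/
def rightPart {A B : Type u} (w : List (A ⊕ B)) : List B := w.filterMap Sum.getRight?

/-- The words on `A ⊕ B` whose subwords on `A` and on `B` are `u` and `v`. -/
def shuffles {A B : Type u} (u : List A) (v : List B) : Set (List (A ⊕ B)) :=
  {w | leftPart w = u ∧ rightPart w = v}

theorem shuffles_finite {A B : Type u} (u : List A) (v : List B) : (shuffles u v).Finite := by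
  have key : ∀ (n : ℕ) (u : List A) (v : List B), u.length + v.length = n →
      (shuffles u v).Finite := by
    intro n
    induction n with
    | zero =>
      intro u v h
      refine (Set.finite_singleton []).subset ?_
      rintro (_ | ⟨a | b, w⟩) ⟨rfl, rfl⟩
      · rfl
      · simp [leftPart] at h
      · simp [rightPart] at h
    | succ n ih =>
      intro u v h
      have h1 : {w | ∃ a w', w = Sum.inl a :: w' ∧ w ∈ shuffles u v}.Finite := by
        cases u with
        | nil =>
          refine Set.finite_empty.subset ?_
          rintro _ ⟨a, w', rfl, hw, -⟩
          simp [leftPart] at hw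
        | cons a u =>
          refine ((ih u v (by simp at h; omega)).image (Sum.inl a :: ·)).subset ?_
          rintro _ ⟨a', w', rfl, hw, hw'⟩
          simp only [leftPart, rightPart, List.filterMap_cons, Sum.getLeft?_inl,
            Sum.getRight?_inl, List.cons.injEq] at hw hw'
          exact ⟨w', ⟨hw.2, hw'⟩, by rw [hw.1]⟩
      have h2 : {w | ∃ b w', w = Sum.inr b :: w' ∧ w ∈ shuffles u v}.Finite := by
        cases v with
        | nil =>
          refine Set.finite_empty.subset ?_
          rintro _ ⟨a, w', rfl, -, hw⟩
          simp [rightPart] at hw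
        | cons b v =>
          refine ((ih u v (by simp at h; omega)).image (Sum.inr b :: ·)).subset ?_
          rintro _ ⟨a', w', rfl, hw', hw⟩
          simp only [leftPart, rightPart, List.filterMap_cons, Sum.getLeft?_inr,
            Sum.getRight?_inr, List.cons.injEq] at hw hw'
          exact ⟨w', ⟨hw', hw.2⟩, by rw [hw.1]⟩
      refine ((h1.union h2).union (Set.finite_singleton [])).subset ?_
      rintro (_ | ⟨a | b, w⟩) hw
      · exact Or.inr rfl
      · exact Or.inl (Or.inl ⟨a, w, rfl, hw⟩)
      · exact Or.inl (Or.inr ⟨b, w, rfl, hw⟩)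
  exact key _ u v rfl

/-- The map `θ`, linear also with respect to infinite sums, sending a word `w` on `A ⊕ B` to
`w_{|A} ⊗ w_{|B}`. As polynomials may have an infinite support, its values are series in two
sets of variables; they need not lie in the image of the algebraic tensor product. -/
def theta (A B : Type u) : Poly K (A ⊕ B) →ₗ[K] (List A × List B → K) where
  toFun f p := ∑ᶠ w ∈ shuffles p.1 p.2, f.1 w
  map_add' _ _ := funext fun p => finsum_mem_add_distrib (shuffles_finite p.1 p.2)
  map_smul' r _ := funext fun p =>
    (smul_finsum_mem (r := r) (shuffles_finite p.1 p.2)).symm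

end

/-! ### Related alphabets and polynomial realizations -/

/-- A set endowed with an `n`-ary relation for each `n`-ary element of the signature `R`. -/
structure RelatedAlphabet (R : Signature.{u}) where
  carrier : Type u
  rel : (r : R.carrier) → (Fin (R.arity r) → carrier) → Prop

/-- An operation on related alphabets which is the disjoint sum on the underlying sets: a
choice of relations on the disjoint sum of the underlying sets of any two alphabets. -/
abbrev SumRel (R : Signature.{u}) : Type (u + 1) :=
  (A B : RelatedAlphabet R) → (r : R.carrier) →
    (Fin (R.arity r) → A.carrier ⊕ B.carrier) → Prop

/-- The value of the operation on two related alphabets. -/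
abbrev SumRel.sum {R : Signature.{u}} (op : SumRel R) (A B : RelatedAlphabet R) :
    RelatedAlphabet R :=
  ⟨A.carrier ⊕ B.carrier, op A B⟩

/-- The class `𝒜` of related alphabets, the operation `op`, the maps `ρ A` for `A` in `𝒜`, and
the alphabet `𝔸` form a polynomial realization of the graded Hopf algebra `H` with homogeneous
components `gr n` and coproduct `Δ`. -/
structure IsPolynomialRealization {K : Type v} [Field K] {H : Type*} [Ring H] [Algebra K H]
    (gr : ℕ → Submodule K H) (Δ : H →ₐ[K] H ⊗[K] H) {R : Signature.{u}}
    (𝒜 : Set (RelatedAlphabet R)) (op : SumRel R)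
    (ρ : (A : RelatedAlphabet R) → H →ₗ[K] Poly K A.carrier) (𝔸 : RelatedAlphabet R) :
    Prop where
  /-- Related alphabet signatures are positive. -/
  positive : R.Positive
  sum_mem : ∀ A ∈ 𝒜, ∀ B ∈ 𝒜, op.sum A B ∈ 𝒜
  /-- The canonical bijection between the two iterated disjoint sums is an isomorphism. -/
  sum_assoc : ∀ A ∈ 𝒜, ∀ B ∈ 𝒜, ∀ C ∈ 𝒜, ∀ r x,
    (op.sum (op.sum A B) C).rel r x ↔
      (op.sum A (op.sum B C)).rel r (fun i => Equiv.sumAssoc _ _ _ (x i))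
  map_one : ∀ A ∈ 𝒜, ρ A 1 = 1
  map_mul : ∀ A ∈ 𝒜, ∀ x y, ρ A (x * y) = ρ A x * ρ A y
  graded : ∀ A ∈ 𝒜, ∀ n, ∀ x ∈ gr n, ρ A x ∈ polyGrading K A.carrier n
  /-- The alphabet doubling trick. -/
  doubling : ∀ A ∈ 𝒜, ∀ B ∈ 𝒜, ∀ x,
    theta K A.carrier B.carrier (ρ (op.sum A B) x) =
      toPairs K A.carrier B.carrier (TensorProduct.map (ρ A) (ρ B) (Δ x))
  mem : 𝔸 ∈ 𝒜
  injective : Function.Injective (ρ 𝔸)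

/-! ### Forest-like alphabets -/

/-- The symbols of the signature of forest-like alphabets. -/
inductive ForestSymbol (T : Type u) : Type u
  | root : ForestSymbol T
  | dec (s : T) : ForestSymbol T
  | edge (j : ℕ+) : ForestSymbol T

/-- The related alphabet signature of forest-like alphabets. -/
abbrev forestSignature (T : Type u) : Signature.{u} where
  carrier := ForestSymbol T
  arity
    | .root => 1
    | .dec _ => 1
    | .edge _ => 2

/-- Forest-like alphabets; there is no condition on the relations. -/
abbrev ForestAlphabet (T : Type u) : Type (u + 1) := RelatedAlphabet (forestSignature T)

namespace ForestAlphabet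

variable {T : Type u} (A : ForestAlphabet T)

/-- The root relation. -/
def IsRoot (a : A.carrier) : Prop := A.rel .root ![a]

/-- The decoration relations. -/
def IsDec (s : T) (a : A.carrier) : Prop := A.rel (.dec s) ![a]

/-- The edge relations. -/
def IsEdge (j : ℕ+) (a a' : A.carrier) : Prop := A.rel (.edge j) ![a, a']

/-- The relations of the disjoint sum of two forest-like alphabets. -/
def sumRel (T : Type u) : SumRel (forestSignature T) := fun A B r =>
  match r with
  | .root => fun x => Sum.elim (IsRoot A) (IsRoot B) (x 0)
  | .dec s => fun x => Sum.elim (IsDec A s) (IsDec B s) (x 0)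
  | .edge j => fun x =>
    match x 0, x 1 with
    | .inl a, .inl a' => IsEdge A j a a'
    | .inr b, .inr b' => IsEdge B j b b'
    | .inl _, .inr b' => IsRoot B b'
    | .inr _, .inl _ => False

/-- The forest-like alphabet of positions; the letter `a^s_u` is the pair `(s, u)`. -/
def positions (T : Type u) : ForestAlphabet T where
  carrier := T × List ℕ
  rel
    | .root => fun x => ∃ l, (x 0).2 = List.replicate l 0
    | .dec s => fun x => (x 0).1 = s
    | .edge j => fun x => ∃ l, (x 1).2 = (x 0).2 ++ [(j : ℕ)] ++ List.replicate l 0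

end ForestAlphabet

/-! ### Internal nodes of forests

Internal nodes are identified with their positions in the left to right preorder traversal,
counted from `0`. -/

namespace STerm

variable {S : Signature.{u}}

/-- The decorations of the internal nodes, in preorder. -/
def decorations : STerm S → List S.carrier
  | leaf => []
  | node s t => s :: (List.ofFn fun i => (t i).decorations).flatten

/-- In `node s t`, the nodes of the subterm `t k` are numbered from this number on. -/
def offset {n : ℕ} (t : Fin n → STerm S) (k : Fin n) : ℕ :=
  1 + ∑ k' ∈ Finset.Iio k, (t k').degree

/-- `t.Edge j i i'`: the internal node `i'` is the `j`-th child of the internal node `i`. -/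
inductive Edge : STerm S → ℕ+ → ℕ → ℕ → Prop
  | root (s : S.carrier) (t : Fin (S.arity s) → STerm S) (k : Fin (S.arity s)) (h : t k ≠ leaf) :
      Edge (node s t) k.val.succPNat 0 (offset t k)
  | child (s : S.carrier) (t : Fin (S.arity s) → STerm S) (k : Fin (S.arity s)) (j : ℕ+)
      (i i' : ℕ) (h : Edge (t k) j i i') :
      Edge (node s t) j (offset t k + i) (offset t k + i')

end STerm

/-- Forests are words of terms. -/
abbrev Forest (S : Signature.{u}) : Type u := List (STerm S)

namespace Forest

variable {S : Signature.{u}} (f : Forest S)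

/-- Number of internal nodes. -/
def degree : ℕ := (f.map STerm.degree).sum

/-- The decorations of the internal nodes, in preorder. -/
def decorations : List S.carrier := f.flatMap STerm.decorations

/-- The internal node `i` is the root of a term of the forest. -/
def IsRoot (i : ℕ) : Prop :=
  ∃ (f₁ : Forest S) (t : STerm S) (f₂ : Forest S),
    f = f₁ ++ t :: f₂ ∧ t ≠ STerm.leaf ∧ i = degree f₁

/-- The internal node `i'` is the `j`-th child of the internal node `i`. -/
def Edge (j : ℕ+) (i i' : ℕ) : Prop :=
  ∃ (f₁ : Forest S) (t : STerm S) (f₂ : Forest S) (k k' : ℕ),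
    f = f₁ ++ t :: f₂ ∧ t.Edge j k k' ∧ i = degree f₁ + k ∧ i' = degree f₁ + k'

/-- The word `w` on the alphabet `A` is compatible with the forest `f`. -/
structure Compatible (A : ForestAlphabet S.carrier) (w : List A.carrier) : Prop where
  length : w.length = degree f
  root : ∀ (i : ℕ) a, IsRoot f i → w[i]? = some a → ForestAlphabet.IsRoot A a
  dec : ∀ (i : ℕ) a s, (decorations f)[i]? = some s → w[i]? = some a → ForestAlphabet.IsDec A s a
  edge : ∀ j (i i' : ℕ) a a', Edge f j i i' → w[i]? = some a → w[i']? = some a' →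
    ForestAlphabet.IsEdge A j a a'

end Forest

section

variable (K : Type v) [Field K] {S : Signature.{u}}

open scoped Classical in
/-- The sum of all the words that are compatible with a forest. -/
def compatibleSum (A : ForestAlphabet S.carrier) (f : Forest S) : Poly K A.carrier :=
  ⟨fun w => if Forest.Compatible f A w then 1 else 0,
    Forest.degree f, fun _ hw => if_neg fun h => hw.ne' h.length⟩

/-- The realizing map `r_A` on `N(T(S))`. -/
def realize (A : ForestAlphabet S.carrier) : NatAlg K (freeOperad S) →ₗ[K] Poly K A.carrier :=
  natLift K (freeOperad S) fun f => compatibleSum K A f.word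

/-- The map `φ` from the natural Hopf algebra of a quotient of the free operad to that of the
free operad, sending `E_x` to the sum of the `E_f` over all the reduced forests `f` that project
onto `x`. The sum is finite as soon as the congruence is of finite type. -/
def quotientMap (c : (freeOperad S).Congruence) :
    NatAlg K c.quotient →ₗ[K] NatAlg K (freeOperad S) :=
  natLift K c.quotient fun x =>
    ∑ᶠ (f : (freeOperad S).RWord) (_ : f.word.map c.proj = x.word), elem K f

/-- The map `r̄_A = r_A ∘ φ`. -/
def quotientRealize (c : (freeOperad S).Congruence) (A : ForestAlphabet S.carrier) :
    NatAlg K c.quotient →ₗ[K] Poly K A.carrier :=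
  realize K A ∘ₗ quotientMap K c

end

end NatHopf

end

open NatHopf

noncomputable section

namespace NatHopf

/-! ### Flattening families of lists -/

/-! Compatibility with a forest is a recursive condition. In preorder, a word compatible with a term
is a letter for the root followed by one block per subterm, and the only condition linking a block
to the rest is the edge from the root letter to the first letter of the block. Replacing the root
relation by an arbitrary predicate `P` therefore gives a class of conditions stable under passing to
subterms (`termWord_iff`, `compatible_iff`), and the resulting sums `termSum` satisfy a recursion on
the first letter (`termSum_node_cons`). Lengths being fixed, concatenations factor uniquely, so the
sum over a forest is the product of the sums over its terms. Summing over equivalence classes,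
`quotientRealize_eq` identifies the realizing map with the algebra morphism that sends each
generator to `classSum`; it is graded because congruent terms have equal degrees.

For the doubling identity, `theta` is compatible with products (`thetaFun_conv`), so generators
suffice. In the sum of `A` and `B` no edge goes from `B` to `A`, and an edge from `A` to `B` only
requires its end to be a root of `B`. In a compatible word, the nodes carrying letters of `A` thus
form an upper part `y` of the term `t`, and those carrying letters of `B` form a forest `y₁ ⋯ yₙ`
hanging below: this is exactly a factorization `t = y[y₁, …, yₙ]` (`doubles_termSum`). Over all `t`
in a class `x`, grouping these factorizations by their projections yields the factorizations of `x`
in the quotient, each with its full product of fibers (`sum_cutTensor_fiber`).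

For injectivity, deleting the zeros of a position leaves the path from the root to the node, so a
word on the positions is compatible with at most one reduced forest (`ForestWord.unique`), and every
forest has a compatible word. Hence each coefficient of `x` is a coefficient of its realization
(`exists_coeff_eq`).

The Hopf algebra axioms are deduced from the realization. Coefficients on the positions separate
elements and tensors, and doubling turns the coproduct into the splitting of an alphabet.
Coassociativity becomes associativity of the sum of alphabets (`comul_coassoc`), and the counit laws
become restriction to one summand. The antipode is the geometric series of `ηε - id`, with `η` the
unit map and `ε` the counit, which is locally finite because the only reduced word of degree zero is
the empty one. -/

theorem sum_Iio_succ {n : ℕ} (f : Fin (n + 1) → ℕ) (k : Fin n) :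
    ∑ k' ∈ Finset.Iio k.succ, f k' = f 0 + ∑ k' ∈ Finset.Iio k, f k'.succ := by
  have h : ∀ {m : ℕ} (k : Fin m), Finset.Iio k = Finset.univ.filter (· < k) := by
    intro m k; ext; simp
  rw [h, h, Finset.sum_filter, Finset.sum_filter, Fin.sum_univ_succ]
  simp

theorem length_flatten_ofFn {α : Type*} {n : ℕ} (ws : Fin n → List α) :
    (List.ofFn ws).flatten.length = ∑ k, (ws k).length := by
  simp [List.length_flatten, List.map_ofFn, List.sum_ofFn]

/-- With the next two lemmas, this passes between the preorder numbering of nodes, where a subterm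
starts after the total size of the previous ones, and the splitting of a word into blocks. -/
theorem getElem?_flatten_ofFn {α : Type*} {n : ℕ} (ws : Fin n → List α) (k : Fin n) (i : ℕ)
    (hi : i < (ws k).length) :
    (List.ofFn ws).flatten[∑ k' ∈ Finset.Iio k, (ws k').length + i]? = (ws k)[i]? := by
  induction n with
  | zero => exact k.elim0
  | succ n ih =>
    rw [List.ofFn_succ, List.flatten_cons]
    cases k using Fin.cases with
    | zero =>
      have : Finset.Iio (0 : Fin (n + 1)) = ∅ := by ext; simp
      rw [this, Finset.sum_empty, zero_add, List.getElem?_append_left hi]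
    | succ k =>
      rw [sum_Iio_succ, add_assoc, List.getElem?_append_right (by omega), Nat.add_sub_cancel_left]
      exact ih (fun k => ws k.succ) k hi

theorem exists_of_getElem?_flatten_ofFn {α : Type*} {n : ℕ} (ws : Fin n → List α) (j : ℕ) (a : α)
    (h : (List.ofFn ws).flatten[j]? = some a) :
    ∃ (k : Fin n) (i : ℕ), j = ∑ k' ∈ Finset.Iio k, (ws k').length + i ∧
      i < (ws k).length ∧ (ws k)[i]? = some a := by
  induction n generalizing j with
  | zero => simp at h
  | succ n ih =>
    rw [List.ofFn_succ, List.flatten_cons] at h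
    by_cases hj : j < (ws 0).length
    · rw [List.getElem?_append_left hj] at h
      refine ⟨0, j, ?_, hj, h⟩
      have : Finset.Iio (0 : Fin (n + 1)) = ∅ := by ext; simp
      rw [this, Finset.sum_empty, zero_add]
    · rw [List.getElem?_append_right (by omega)] at h
      obtain ⟨k, i, hk, hi, hw⟩ := ih (fun k => ws k.succ) _ h
      refine ⟨k.succ, i, ?_, hi, hw⟩
      rw [sum_Iio_succ]
      omega

theorem exists_flatten_ofFn_eq {α : Type*} {n : ℕ} (d : Fin n → ℕ) (w : List α)
    (hw : w.length = ∑ k, d k) :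
    ∃ ws : Fin n → List α, w = (List.ofFn ws).flatten ∧ ∀ k, (ws k).length = d k := by
  induction n generalizing w with
  | zero => exact ⟨fun _ => [], by simpa using hw, fun k => k.elim0⟩
  | succ n ih =>
    rw [Fin.sum_univ_succ] at hw
    obtain ⟨ws, h, h'⟩ := ih (fun k => d k.succ) (w.drop (d 0)) (by simp; omega)
    refine ⟨Fin.cons (w.take (d 0)) ws, ?_, fun k => ?_⟩
    · rw [List.ofFn_succ, List.flatten_cons]
      simp only [Fin.cons_zero, Fin.cons_succ]
      rw [← h, List.take_append_drop]
    · cases k using Fin.cases with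
      | zero => simp; omega
      | succ k => simpa using h' k

/-! ### Words compatible with a term -/

section TermWord

variable {S : Signature.{u}}

/-- `TermWord A t P w`: the word `w` satisfies the compatibility conditions of the internal nodes
of the term `t`, the condition on the letter of the root being `P`. -/
def TermWord (A : ForestAlphabet S.carrier) :
    STerm S → (A.carrier → Prop) → List A.carrier → Prop
  | .leaf, _, w => w = []
  | .node s t, P, w => ∃ (a : A.carrier) (ws : Fin (S.arity s) → List A.carrier),
      w = a :: (List.ofFn ws).flatten ∧ P a ∧ ForestAlphabet.IsDec A s a ∧
        ∀ k, TermWord A (t k) (ForestAlphabet.IsEdge A k.val.succPNat a) (ws k)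

/-- `ForestWord A f w`: the word `w` is a concatenation of words that are compatible with the
terms of `f`. -/
def ForestWord (A : ForestAlphabet S.carrier) : Forest S → List A.carrier → Prop
  | [], w => w = []
  | t :: f, w => ∃ w₁ w₂, w = w₁ ++ w₂ ∧ TermWord A t (ForestAlphabet.IsRoot A) w₁ ∧
      ForestWord A f w₂

variable {A : ForestAlphabet S.carrier}

theorem TermWord.length {t : STerm S} {P : A.carrier → Prop} {w : List A.carrier}
    (h : TermWord A t P w) : w.length = t.degree := by
  induction t generalizing P w with
  | leaf => rw [TermWord] at h; rw [h]; rfl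
  | node s t ih =>
    rw [TermWord] at h
    obtain ⟨a, ws, rfl, -, -, h⟩ := h
    rw [List.length_cons, length_flatten_ofFn, STerm.degree, add_comm]
    congr 1
    exact Finset.sum_congr rfl fun k _ => ih k (h k)

theorem STerm.length_decorations (t : STerm S) : t.decorations.length = t.degree := by
  induction t with
  | leaf => rfl
  | node s t ih =>
    rw [STerm.decorations, List.length_cons, length_flatten_ofFn, STerm.degree, add_comm]
    simp only [ih]

theorem STerm.degree_eq_zero_iff (t : STerm S) : t.degree = 0 ↔ t = .leaf := by
  cases t <;> simp [STerm.degree]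

theorem STerm.edge_node_iff {s : S.carrier} {t : Fin (S.arity s) → STerm S} {j : ℕ+} {i i' : ℕ} :
    (STerm.node s t).Edge j i i' ↔
      (∃ k : Fin (S.arity s), t k ≠ .leaf ∧ j = k.val.succPNat ∧ i = 0 ∧ i' = STerm.offset t k) ∨
      ∃ (k : Fin (S.arity s)) (l l' : ℕ), (t k).Edge j l l' ∧ i = STerm.offset t k + l ∧
        i' = STerm.offset t k + l' := by
  constructor
  · intro h
    cases h with
    | root s t k h => exact Or.inl ⟨k, h, rfl, rfl, rfl⟩
    | child s t k j i i' h => exact Or.inr ⟨k, i, i', h, rfl, rfl⟩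
  · rintro (⟨k, h, rfl, rfl, rfl⟩ | ⟨k, l, l', h, rfl, rfl⟩)
    · exact .root s t k h
    · exact .child s t k j l l' h

/-- Both ends of an edge of a subterm index letters inside the block of that subterm; this is what
allows edges to be transported between a term and its subterms. -/
theorem STerm.Edge.lt_degree {t : STerm S} {j : ℕ+} {i i' : ℕ} (h : t.Edge j i i') :
    i < t.degree ∧ i' < t.degree := by
  -- The interval of numbers of `t k` ends within the term, since `k` and the smaller indices form a
  -- subset of all the indices.
  have key : ∀ (s : S.carrier) (t : Fin (S.arity s) → STerm S) (k : Fin (S.arity s)),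
      STerm.offset t k + (t k).degree ≤ (STerm.node s t).degree := by
    intro s t k
    rw [STerm.offset, STerm.degree, add_assoc, add_comm (Finset.sum _ _)]
    have : insert k (Finset.Iio k) ⊆ Finset.univ := Finset.subset_univ _
    have := Finset.sum_le_sum_of_subset (f := fun k => (t k).degree) this
    rw [Finset.sum_insert (by simp)] at this
    omega
  induction h with
  | root s t k h =>
    have h1 := key s t k
    have h2 := (STerm.degree_eq_zero_iff (t k)).not.2 h
    constructor
    · rw [STerm.degree]; omega
    · omega
  | child s t k j i i' h ih =>
    have h1 := key s t k
    omega

/-- The compatibility conditions on the letters of a word, with the condition `P` on the letter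
of the root. -/
structure TermCompatible (A : ForestAlphabet S.carrier) (t : STerm S) (P : A.carrier → Prop)
    (w : List A.carrier) : Prop where
  length : w.length = t.degree
  root : ∀ a, t ≠ .leaf → w[0]? = some a → P a
  dec : ∀ (i : ℕ) a s, t.decorations[i]? = some s → w[i]? = some a → ForestAlphabet.IsDec A s a
  edge : ∀ j (i i' : ℕ) a a', t.Edge j i i' → w[i]? = some a → w[i']? = some a' →
    ForestAlphabet.IsEdge A j a a'

/-- The leading 1 in `STerm.offset` accounts for the letter of the root, placed before all blocks.
-/
theorem getElem?_cons_flatten {s : S.carrier} {t : Fin (S.arity s) → STerm S} {α : Type*} (a : α)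
    {ws : Fin (S.arity s) → List α} (hl : ∀ k, (ws k).length = (t k).degree)
    (k : Fin (S.arity s)) (i : ℕ) (hi : i < (t k).degree) :
    (a :: (List.ofFn ws).flatten)[STerm.offset t k + i]? = (ws k)[i]? := by
  rw [← getElem?_flatten_ofFn ws k i (by rw [hl]; exact hi), STerm.offset, add_assoc, add_comm 1,
    List.getElem?_cons_succ]
  simp only [hl]

/-- Nodes of `t k` occupy consecutive numbers, and the only edge entering this block comes from the
root of the whole term and ends at the root of `t k`. It becomes the root condition of the block, so
the induction must leave `P` arbitrary. -/
theorem termWord_iff (t : STerm S) (P : A.carrier → Prop) (w : List A.carrier) :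
    TermWord A t P w ↔ TermCompatible A t P w := by
  induction t generalizing P w with
  | leaf =>
    rw [TermWord]
    constructor
    · rintro rfl
      exact ⟨rfl, by simp, by simp, by simp⟩
    · intro h
      exact List.eq_nil_of_length_eq_zero h.length
  | node s t ih =>
    constructor
    · intro h
      have hlen := h.length
      rw [TermWord] at h
      obtain ⟨a, ws, rfl, hP, hs, h⟩ := h
      have hl := fun k => (h k).length
      have hd := fun k => STerm.length_decorations (t k)
      have hc := fun k => (ih k _ _).1 (h k)
      refine ⟨hlen, fun b _ hb => ?_, fun i b s' hi hb => ?_, fun j i i' b b' he hb hb' => ?_⟩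
      · obtain rfl : a = b := by simpa using hb
        exact hP
      · rw [STerm.decorations] at hi
        cases i with
        | zero =>
          obtain rfl : a = b := by simpa using hb
          obtain rfl : s = s' := by simpa using hi
          exact hs
        | succ i =>
          rw [List.getElem?_cons_succ] at hi hb
          obtain ⟨k, l, rfl, hlt, hl'⟩ := exists_of_getElem?_flatten_ofFn _ _ _ hi
          simp only [hd] at hb hlt
          simp only [← hl] at hb hlt
          rw [getElem?_flatten_ofFn ws k l hlt] at hb
          exact (hc k).dec l b s' hl' hb
      · rw [STerm.edge_node_iff] at he
        obtain ⟨k, hk, rfl, rfl, rfl⟩ | ⟨k, l, l', he, rfl, rfl⟩ := he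
        · obtain rfl : a = b := by simpa using hb
          have := getElem?_cons_flatten a hl k 0
            (Nat.pos_of_ne_zero ((STerm.degree_eq_zero_iff (t k)).not.2 hk))
          rw [add_zero] at this
          exact (hc k).root b' hk (this ▸ hb')
        · rw [getElem?_cons_flatten a hl k _ he.lt_degree.1] at hb
          rw [getElem?_cons_flatten a hl k _ he.lt_degree.2] at hb'
          exact (hc k).edge j l l' b b' he hb hb'
    · intro h
      have hlen := h.length
      rw [STerm.degree] at hlen
      obtain - | ⟨a, w⟩ := w
      · simp at hlen; omega
      obtain ⟨ws, rfl, hl⟩ := exists_flatten_ofFn_eq (fun k => (t k).degree) w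
        (by simp at hlen; omega)
      have hd := fun k => STerm.length_decorations (t k)
      rw [TermWord]
      refine ⟨a, ws, rfl, h.root a (by simp) rfl, h.dec 0 a s rfl rfl, fun k => ?_⟩
      refine (ih k _ _).2 ⟨hl k, fun b hk hb => ?_, fun i b s' hi hb => ?_,
        fun j i i' b b' he hb hb' => ?_⟩
      · have := getElem?_cons_flatten a hl k 0
          (Nat.pos_of_ne_zero ((STerm.degree_eq_zero_iff (t k)).not.2 hk))
        rw [add_zero, hb] at this
        exact h.edge _ 0 _ a b (.root s t k hk) rfl this
      · have hi' : i < (t k).degree := by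
          rw [← hl]; exact (List.getElem?_eq_some_iff.1 hb).1
        refine h.dec (STerm.offset t k + i) b s' ?_ ?_
        · rw [STerm.decorations, getElem?_cons_flatten s hd k i hi', hi]
        · rw [getElem?_cons_flatten a hl k i hi', hb]
      · refine h.edge j _ _ b b' (.child s t k j i i' he) ?_ ?_
        · rw [getElem?_cons_flatten a hl k i he.lt_degree.1, hb]
        · rw [getElem?_cons_flatten a hl k i' he.lt_degree.2, hb']

theorem Forest.degree_cons (t : STerm S) (f : Forest S) :
    Forest.degree (t :: f) = t.degree + Forest.degree f := by
  simp [Forest.degree]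

theorem Forest.isRoot_cons_iff {t : STerm S} {f : Forest S} {i : ℕ} :
    Forest.IsRoot (t :: f) i ↔ (t ≠ .leaf ∧ i = 0) ∨
      ∃ i', i = t.degree + i' ∧ Forest.IsRoot f i' := by
  constructor
  · rintro ⟨f₁, t', f₂, h, ht, rfl⟩
    obtain - | ⟨t₁, f₁⟩ := f₁
    · obtain ⟨rfl, rfl⟩ := List.cons.inj h
      exact Or.inl ⟨ht, rfl⟩
    · obtain ⟨rfl, rfl⟩ := List.cons.inj h
      exact Or.inr ⟨_, Forest.degree_cons _ _, f₁, t', f₂, rfl, ht, rfl⟩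
  · rintro (⟨ht, rfl⟩ | ⟨_, rfl, f₁, t', f₂, rfl, ht, rfl⟩)
    · exact ⟨[], t, f, rfl, ht, rfl⟩
    · exact ⟨t :: f₁, t', f₂, rfl, ht, (Forest.degree_cons _ _).symm⟩

theorem Forest.edge_cons_iff {t : STerm S} {f : Forest S} {j : ℕ+} {i i' : ℕ} :
    Forest.Edge (t :: f) j i i' ↔ t.Edge j i i' ∨
      ∃ l l', i = t.degree + l ∧ i' = t.degree + l' ∧ Forest.Edge f j l l' := by
  constructor
  · rintro ⟨f₁, t', f₂, k, k', h, ht, rfl, rfl⟩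
    obtain - | ⟨t₁, f₁⟩ := f₁
    · obtain ⟨rfl, rfl⟩ := List.cons.inj h
      exact Or.inl (by simpa [Forest.degree] using ht)
    · obtain ⟨rfl, rfl⟩ := List.cons.inj h
      exact Or.inr ⟨_, _, by rw [Forest.degree_cons, add_assoc], by
        rw [Forest.degree_cons, add_assoc], f₁, t', f₂, k, k', rfl, ht, rfl, rfl⟩
  · rintro (h | ⟨_, _, rfl, rfl, f₁, t', f₂, k, k', rfl, ht, rfl, rfl⟩)
    · exact ⟨[], t, f, i, i', rfl, h, by simp [Forest.degree], by simp [Forest.degree]⟩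
    · exact ⟨t :: f₁, t', f₂, k, k', rfl, ht, by rw [Forest.degree_cons, add_assoc], by
        rw [Forest.degree_cons, add_assoc]⟩

/-- No edge joins two different terms of a forest, so the conditions decouple along the cuts of the
word at the degrees of the terms. -/
theorem compatible_iff (f : Forest S) (w : List A.carrier) :
    Forest.Compatible f A w ↔ ForestWord A f w := by
  induction f generalizing w with
  | nil =>
    rw [ForestWord]
    constructor
    · intro h
      exact List.eq_nil_of_length_eq_zero h.length
    · rintro rfl
      exact ⟨rfl, by simp, by simp, by simp⟩
  | cons t f ih =>
    rw [ForestWord]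
    constructor
    · intro h
      have hl := h.length
      rw [Forest.degree_cons] at hl
      have h1 : ∀ (i : ℕ) a, (w.take t.degree)[i]? = some a → w[i]? = some a := by
        intro i a hi
        rw [List.getElem?_take] at hi
        split_ifs at hi
        exact hi
      refine ⟨w.take t.degree, w.drop t.degree, (List.take_append_drop _ _).symm,
        (termWord_iff _ _ _).2 ⟨by simp; omega, fun a ht ha => ?_, fun i a s hs ha => ?_,
          fun j i i' a a' he ha ha' => ?_⟩,
        (ih _).1 ⟨by simp; omega, fun i a hi ha => ?_, fun i a s hs ha => ?_,
          fun j i i' a a' he ha ha' => ?_⟩⟩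
      · exact h.root 0 a (Forest.isRoot_cons_iff.2 (Or.inl ⟨ht, rfl⟩)) (h1 _ _ ha)
      · refine h.dec i a s ?_ (h1 _ _ ha)
        rw [Forest.decorations, List.flatMap_cons, List.getElem?_append_left, hs]
        exact (List.getElem?_eq_some_iff.1 hs).1
      · exact h.edge j i i' a a' (Forest.edge_cons_iff.2 (Or.inl he)) (h1 _ _ ha) (h1 _ _ ha')
      · rw [List.getElem?_drop] at ha
        exact h.root _ a (Forest.isRoot_cons_iff.2 (Or.inr ⟨i, rfl, hi⟩)) ha
      · rw [List.getElem?_drop] at ha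
        refine h.dec _ a s ?_ ha
        rw [Forest.decorations, List.flatMap_cons, ← STerm.length_decorations,
          List.getElem?_append_right (by omega), Nat.add_sub_cancel_left]
        exact hs
      · rw [List.getElem?_drop] at ha ha'
        exact h.edge j _ _ a a' (Forest.edge_cons_iff.2 (Or.inr ⟨i, i', rfl, rfl, he⟩)) ha ha'
    · rintro ⟨w₁, w₂, rfl, h₁, h₂⟩
      have hl := h₁.length
      replace h₁ := (termWord_iff _ _ _).1 h₁
      replace h₂ := (ih _).2 h₂
      refine ⟨?_, fun i a hi ha => ?_, fun i a s hs ha => ?_, fun j i i' a a' he ha ha' => ?_⟩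
      · rw [List.length_append, hl, h₂.length, Forest.degree_cons]
      · obtain ⟨ht, rfl⟩ | ⟨i, rfl, hi'⟩ := Forest.isRoot_cons_iff.1 hi
        · rw [List.getElem?_append_left] at ha
          · exact h₁.root a ht ha
          · rw [hl]
            exact Nat.pos_of_ne_zero ((STerm.degree_eq_zero_iff t).not.2 ht)
        · rw [← hl, List.getElem?_append_right (by omega), Nat.add_sub_cancel_left] at ha
          exact h₂.root i a hi' ha
      · rw [Forest.decorations, List.flatMap_cons] at hs
        by_cases hi : i < t.degree
        · rw [List.getElem?_append_left (by rw [STerm.length_decorations]; exact hi)] at hs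
          rw [List.getElem?_append_left (by rw [hl]; exact hi)] at ha
          exact h₁.dec i a s hs ha
        · rw [List.getElem?_append_right (by rw [STerm.length_decorations]; omega),
            STerm.length_decorations] at hs
          rw [List.getElem?_append_right (by omega), hl] at ha
          exact h₂.dec _ a s hs ha
      · obtain he | ⟨l, l', rfl, rfl, he'⟩ := Forest.edge_cons_iff.1 he
        · rw [List.getElem?_append_left (by rw [hl]; exact he.lt_degree.1)] at ha
          rw [List.getElem?_append_left (by rw [hl]; exact he.lt_degree.2)] at ha'
          exact h₁.edge j i i' a a' he ha ha'
        · rw [← hl, List.getElem?_append_right (by omega), Nat.add_sub_cancel_left] at ha ha'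
          exact h₂.edge j l l' a a' he' ha ha'

end TermWord

/-! ### Sums of compatible words -/

section TermSum

variable (K : Type v) [Field K] {S : Signature.{u}} (A : ForestAlphabet S.carrier)

open scoped Classical in
/-- The sum of the words satisfying the compatibility conditions of a term, with the condition
`P` on the letter of the root. -/
def termSum (P : A.carrier → Prop) (t : STerm S) : Poly K A.carrier :=
  ⟨fun w => if TermWord A t P w then 1 else 0,
    t.degree, fun _ hw => if_neg fun h => hw.ne' h.length⟩

open scoped Classical in
-- Words satisfying `Q₁` have a common length, so at most one cut of `w` contributes and the
-- convolution takes only the values 0 and 1.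
theorem conv_indicator {α : Type u} {Q₁ Q₂ : List α → Prop} {n : ℕ}
    (h₁ : ∀ w, Q₁ w → w.length = n) (w : List α) :
    Poly.conv (fun w => if Q₁ w then (1 : K) else 0) (fun w => if Q₂ w then 1 else 0) w =
      if ∃ w₁ w₂, w = w₁ ++ w₂ ∧ Q₁ w₁ ∧ Q₂ w₂ then 1 else 0 := by
  rw [Poly.conv]
  split_ifs with h
  · obtain ⟨w₁, w₂, rfl, hw₁, hw₂⟩ := h
    rw [Finset.sum_eq_single w₁.length]
    · simp [hw₁, hw₂]
    · intro i hi hne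
      rw [if_neg, zero_mul]
      intro h
      have := (h₁ _ h).trans (h₁ _ hw₁).symm
      simp at hi this
      omega
    · intro h
      simp at h
  · refine Finset.sum_eq_zero fun i _ => ?_
    by_cases hQ : Q₁ (w.take i)
    · rw [if_neg (c := Q₂ _), mul_zero]
      exact fun hQ' => h ⟨_, _, (List.take_append_drop i w).symm, hQ, hQ'⟩
    · rw [if_neg hQ, zero_mul]

open scoped Classical in
theorem prod_termSum_apply {n : ℕ} (P : Fin n → A.carrier → Prop) (t : Fin n → STerm S)
    (w : List A.carrier) :
    ((List.ofFn fun k => termSum K A (P k) (t k)).prod).1 w =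
      if ∃ ws : Fin n → List A.carrier, w = (List.ofFn ws).flatten ∧
        ∀ k, TermWord A (t k) (P k) (ws k) then 1 else 0 := by
  induction n generalizing w with
  | zero =>
    simp only [List.ofFn_zero, List.prod_nil, List.flatten_nil, IsEmpty.forall_iff, and_true,
      exists_const]
    change Poly.delta w = _
    cases w <;> simp [Poly.delta]
  | succ n ih =>
    rw [List.ofFn_succ, List.prod_cons]
    refine (congrArg (fun g => Poly.conv _ g w) (funext (ih _ _))).trans ?_
    refine (conv_indicator K (fun w h => TermWord.length h) w).trans (if_congr ?_ rfl rfl)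
    constructor
    · rintro ⟨w₁, w₂, rfl, h₁, ws, rfl, h₂⟩
      refine ⟨Fin.cons w₁ ws, by simp [List.ofFn_succ], fun k => ?_⟩
      cases k using Fin.cases with
      | zero => exact h₁
      | succ k => exact h₂ k
    · rintro ⟨ws, rfl, h⟩
      exact ⟨ws 0, _, by rw [List.ofFn_succ, List.flatten_cons], h 0, fun k => ws k.succ, rfl,
        fun k => h k.succ⟩

theorem termSum_leaf (P : A.carrier → Prop) : termSum K A P .leaf = 1 := by
  refine Subtype.ext (funext fun w => ?_)
  classical
  change ite _ _ _ = Poly.delta w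
  cases w <;> simp [Poly.delta, TermWord]

theorem termSum_node_nil (P : A.carrier → Prop) (s : S.carrier) (t : Fin (S.arity s) → STerm S) :
    (termSum K A P (.node s t)).1 [] = 0 := by
  classical
  change ite _ _ _ = _
  simp [TermWord]

open scoped Classical in
-- Once the root letter is fixed, the blocks of the subterms are independent. The inductions on
-- terms in the doubling argument rest on this recursion.
theorem termSum_node_cons (P : A.carrier → Prop) (s : S.carrier) (t : Fin (S.arity s) → STerm S)
    (a : A.carrier) (w : List A.carrier) :
    (termSum K A P (.node s t)).1 (a :: w) =
      if P a ∧ ForestAlphabet.IsDec A s a then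
        ((List.ofFn fun k : Fin (S.arity s) => termSum K A
          (ForestAlphabet.IsEdge A k.val.succPNat a) (t k)).prod).1 w
      else 0 := by
  rw [prod_termSum_apply]
  change ite _ _ _ = _
  rw [← ite_and]
  refine if_congr ?_ rfl rfl
  rw [TermWord]
  constructor
  · rintro ⟨a', ws, h, hP, hs, hw⟩
    obtain ⟨rfl, rfl⟩ := List.cons.inj h
    exact ⟨⟨hP, hs⟩, ws, rfl, hw⟩
  · rintro ⟨⟨hP, hs⟩, ws, rfl, hw⟩
    exact ⟨a, ws, rfl, hP, hs, hw⟩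

theorem compatibleSum_nil : compatibleSum K A ([] : Forest S) = 1 := by
  refine Subtype.ext (funext fun w => ?_)
  classical
  change ite _ _ _ = Poly.delta w
  rw [compatible_iff]
  cases w <;> simp [Poly.delta, ForestWord]

theorem compatibleSum_cons (t : STerm S) (f : Forest S) :
    compatibleSum K A (t :: f) =
      termSum K A (ForestAlphabet.IsRoot A) t * compatibleSum K A f := by
  classical
  refine Subtype.ext (funext fun w => ?_)
  refine Eq.trans ?_ (conv_indicator K (fun w h => TermWord.length h) w).symm
  refine if_congr ?_ rfl rfl
  rw [compatible_iff, ForestWord]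
  simp only [compatible_iff]

end TermSum

/-! ### Restriction to two subalphabets -/

section Theta

variable {K : Type v} [Field K] {A B : Type u}

/-- The map `θ` on arbitrary functions on words. -/
def thetaFun (f : List (A ⊕ B) → K) (u : List A) (v : List B) : K :=
  ∑ w ∈ (shuffles_finite u v).toFinset, f w

theorem theta_apply (f : Poly K (A ⊕ B)) (u : List A) (v : List B) :
    theta K A B f (u, v) = thetaFun f.1 u v :=
  finsum_mem_eq_finite_toFinset_sum _ (shuffles_finite u v)

theorem thetaFun_add (f g : List (A ⊕ B) → K) (u : List A) (v : List B) :
    thetaFun (fun w => f w + g w) u v = thetaFun f u v + thetaFun g u v :=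
  Finset.sum_add_distrib

theorem thetaFun_mul_left (r : K) (f : List (A ⊕ B) → K) (u : List A) (v : List B) :
    thetaFun (fun w => r * f w) u v = r * thetaFun f u v :=
  (Finset.mul_sum _ _ _).symm

theorem thetaFun_zero (u : List A) (v : List B) :
    thetaFun (fun _ : List (A ⊕ B) => (0 : K)) u v = 0 :=
  Finset.sum_const_zero

theorem leftPart_nil : leftPart ([] : List (A ⊕ B)) = [] := rfl

theorem rightPart_nil : rightPart ([] : List (A ⊕ B)) = [] := rfl

theorem leftPart_inl (a : A) (w : List (A ⊕ B)) : leftPart (.inl a :: w) = a :: leftPart w := rfl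

theorem leftPart_inr (b : B) (w : List (A ⊕ B)) : leftPart (.inr b :: w) = leftPart w := rfl

theorem rightPart_inl (a : A) (w : List (A ⊕ B)) : rightPart (.inl a :: w) = rightPart w := rfl

theorem rightPart_inr (b : B) (w : List (A ⊕ B)) :
    rightPart (.inr b :: w) = b :: rightPart w := rfl

theorem shuffles_nil_nil : shuffles ([] : List A) ([] : List B) = {[]} := by
  ext w
  obtain - | ⟨a | b, w⟩ := w <;> simp [shuffles, leftPart_nil, rightPart_nil, leftPart_inl,
    rightPart_inr]

theorem shuffles_cons_nil (a : A) (u : List A) :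
    shuffles (a :: u) ([] : List B) = (Sum.inl a :: ·) '' shuffles u [] := by
  ext w
  obtain - | ⟨a' | b, w⟩ := w
  · simp [shuffles, leftPart_nil]
  · simp [shuffles, leftPart_inl, rightPart_inl]; grind
  · simp [shuffles, rightPart_inr]

theorem shuffles_nil_cons (b : B) (v : List B) :
    shuffles ([] : List A) (b :: v) = (Sum.inr b :: ·) '' shuffles [] v := by
  ext w
  obtain - | ⟨a | b', w⟩ := w
  · simp [shuffles, rightPart_nil]
  · simp [shuffles, leftPart_inl]
  · simp [shuffles, leftPart_inr, rightPart_inr]; grind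

theorem shuffles_cons_cons (a : A) (u : List A) (b : B) (v : List B) :
    shuffles (a :: u) (b :: v) =
      (Sum.inl a :: ·) '' shuffles u (b :: v) ∪ (Sum.inr b :: ·) '' shuffles (a :: u) v := by
  ext w
  obtain - | ⟨a' | b', w⟩ := w
  · simp [shuffles, leftPart_nil]
  · simp [shuffles, leftPart_inl, rightPart_inl]; grind
  · simp [shuffles, leftPart_inr, rightPart_inr]; grind

theorem thetaFun_nil_nil (f : List (A ⊕ B) → K) : thetaFun f [] [] = f [] := by
  simp only [thetaFun, shuffles_nil_nil]
  simp

theorem thetaFun_cons_nil (f : List (A ⊕ B) → K) (a : A) (u : List A) :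
    thetaFun f (a :: u) [] = thetaFun (fun w => f (Sum.inl a :: w)) u [] := by
  classical
  have : (shuffles_finite (a :: u) ([] : List B)).toFinset =
      (shuffles_finite u []).toFinset.image (Sum.inl a :: ·) := by
    ext w; simp [shuffles_cons_nil]
  rw [thetaFun, this, Finset.sum_image (by simp)]
  rfl

theorem thetaFun_nil_cons (f : List (A ⊕ B) → K) (b : B) (v : List B) :
    thetaFun f [] (b :: v) = thetaFun (fun w => f (Sum.inr b :: w)) [] v := by
  classical
  have : (shuffles_finite ([] : List A) (b :: v)).toFinset =
      (shuffles_finite [] v).toFinset.image (Sum.inr b :: ·) := by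
    ext w; simp [shuffles_nil_cons]
  rw [thetaFun, this, Finset.sum_image (by simp)]
  rfl

/-- A shuffle of two nonempty words starts with the first letter of one or of the other, and the two
cases are disjoint. -/
theorem thetaFun_cons_cons (f : List (A ⊕ B) → K) (a : A) (u : List A) (b : B) (v : List B) :
    thetaFun f (a :: u) (b :: v) = thetaFun (fun w => f (Sum.inl a :: w)) u (b :: v) +
      thetaFun (fun w => f (Sum.inr b :: w)) (a :: u) v := by
  classical
  have : (shuffles_finite (a :: u) (b :: v)).toFinset =
      (shuffles_finite u (b :: v)).toFinset.image (Sum.inl a :: ·) ∪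
      (shuffles_finite (a :: u) v).toFinset.image (Sum.inr b :: ·) := by
    ext w; simp [shuffles_cons_cons]
  rw [thetaFun, this, Finset.sum_union, Finset.sum_image (by simp), Finset.sum_image (by simp)]
  · rfl
  · rw [Finset.disjoint_left]
    simp

/-- Convolution of functions on pairs of words. -/
def conv₂ (F G : List A → List B → K) (u : List A) (v : List B) : K :=
  ∑ i ∈ Finset.range (u.length + 1), ∑ j ∈ Finset.range (v.length + 1),
    F (u.take i) (v.take j) * G (u.drop i) (v.drop j)

/-- Restriction to a subalphabet commutes with concatenation: cutting a shuffle cuts both of its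
restrictions, and conversely. The proof removes the first letter of the shuffle and checks that both
sides obey the same recursion. -/
theorem thetaFun_conv (f g : List (A ⊕ B) → K) (u : List A) (v : List B) :
    thetaFun (Poly.conv f g) u v = conv₂ (thetaFun f) (thetaFun g) u v := by
  induction hn : u.length + v.length generalizing f u v with
  | zero =>
    obtain ⟨hu, hv⟩ := Nat.add_eq_zero_iff.1 hn
    obtain rfl := List.eq_nil_of_length_eq_zero hu
    obtain rfl := List.eq_nil_of_length_eq_zero hv
    simp [conv₂, thetaFun_nil_nil, Poly.conv_nil]
  | succ n ih =>
    obtain - | ⟨a, u⟩ := u <;> obtain - | ⟨b, v⟩ := v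
    · simp at hn
    · rw [thetaFun_nil_cons]
      simp only [Poly.conv_cons]
      rw [thetaFun_add, thetaFun_mul_left, ih _ _ _ (by simp at hn ⊢; omega), conv₂, conv₂]
      simp only [List.length_nil, zero_add, Finset.sum_range_one, List.length_cons,
        Finset.sum_range_succ' _ (v.length + 1), List.take_zero, List.drop_zero,
        List.take_succ_cons, List.drop_succ_cons, thetaFun_nil_cons, thetaFun_nil_nil]
      rw [add_comm]
    · rw [thetaFun_cons_nil]
      simp only [Poly.conv_cons]
      rw [thetaFun_add, thetaFun_mul_left, ih _ _ _ (by simp at hn ⊢; omega), conv₂, conv₂]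
      simp only [List.length_nil, zero_add, Finset.sum_range_one, List.length_cons,
        Finset.sum_range_succ' _ (u.length + 1), List.take_zero, List.drop_zero,
        List.take_succ_cons, List.drop_succ_cons, thetaFun_cons_nil, thetaFun_nil_nil]
      rw [add_comm]
    · rw [thetaFun_cons_cons]
      simp only [Poly.conv_cons]
      rw [thetaFun_add, thetaFun_mul_left, thetaFun_add, thetaFun_mul_left,
        ih _ _ _ (by simp at hn ⊢; omega), ih _ _ _ (by simp at hn ⊢; omega), conv₂, conv₂, conv₂]
      simp only [List.length_cons,
        Finset.sum_range_succ' _ (u.length + 1), Finset.sum_range_succ' _ (v.length + 1),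
        List.take_zero, List.drop_zero,
        List.take_succ_cons, List.drop_succ_cons, thetaFun_cons_nil, thetaFun_nil_cons,
        thetaFun_cons_cons, thetaFun_nil_nil, add_mul, mul_add, Finset.sum_add_distrib]
      ring

theorem toPairs_tmul (f : Poly K A) (g : Poly K B) (p : List A × List B) :
    toPairs K A B (f ⊗ₜ g) p = f.1 p.1 * g.1 p.2 := rfl

theorem toPairs_mul (T U : Poly K A ⊗[K] Poly K B) (u : List A) (v : List B) :
    toPairs K A B (T * U) (u, v) =
      conv₂ (fun u v => toPairs K A B T (u, v)) (fun u v => toPairs K A B U (u, v)) u v := by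
  induction T using TensorProduct.induction_on with
  | zero => simp [conv₂]
  | add T T' hT hT' =>
    rw [add_mul, map_add, Pi.add_apply, hT, hT']
    simp [conv₂, add_mul, Finset.sum_add_distrib]
  | tmul f g =>
    induction U using TensorProduct.induction_on with
    | zero => simp [conv₂]
    | add U U' hU hU' =>
      rw [mul_add, map_add, Pi.add_apply, hU, hU']
      simp [conv₂, mul_add, Finset.sum_add_distrib]
    | tmul f' g' =>
      rw [Algebra.TensorProduct.tmul_mul_tmul, toPairs_tmul]
      change Poly.conv f.1 f'.1 u * Poly.conv g.1 g'.1 v = _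
      simp only [Poly.conv, conv₂, Finset.sum_mul_sum, toPairs_tmul]
      exact Finset.sum_congr rfl fun i _ => Finset.sum_congr rfl fun j _ => by ring

/-- The tensor `T` represents the image of the polynomial `P` by `θ`. -/
def Doubles (P : Poly K (A ⊕ B)) (T : Poly K A ⊗[K] Poly K B) : Prop :=
  theta K A B P = toPairs K A B T

theorem Doubles.mul {P Q : Poly K (A ⊕ B)} {T U : Poly K A ⊗[K] Poly K B}
    (hP : Doubles P T) (hQ : Doubles Q U) : Doubles (P * Q) (T * U) := by
  funext ⟨u, v⟩
  rw [theta_apply, toPairs_mul, ← hP, ← hQ]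
  simp only [theta_apply]
  exact thetaFun_conv P.1 Q.1 u v

theorem Doubles.one : Doubles (1 : Poly K (A ⊕ B)) (1 : Poly K A ⊗[K] Poly K B) := by
  funext ⟨u, v⟩
  rw [theta_apply, Algebra.TensorProduct.one_def, toPairs_tmul]
  change thetaFun Poly.delta u v = Poly.delta u * Poly.delta v
  obtain - | ⟨a, u⟩ := u <;> obtain - | ⟨b, v⟩ := v <;>
    simp [thetaFun_nil_nil, thetaFun_nil_cons, thetaFun_cons_nil, thetaFun_cons_cons, Poly.delta,
      thetaFun_zero]

theorem Doubles.sum {ι : Type*} {s : Finset ι} {P : ι → Poly K (A ⊕ B)}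
    {T : ι → Poly K A ⊗[K] Poly K B} (h : ∀ i ∈ s, Doubles (P i) (T i)) :
    Doubles (∑ i ∈ s, P i) (∑ i ∈ s, T i) := by
  rw [Doubles, map_sum, map_sum]
  exact Finset.sum_congr rfl h

theorem Doubles.add {P Q : Poly K (A ⊕ B)} {T U : Poly K A ⊗[K] Poly K B}
    (hP : Doubles P T) (hQ : Doubles Q U) : Doubles (P + Q) (T + U) := by
  rw [Doubles, map_add, map_add, hP, hQ]

theorem Doubles.smul (r : K) {P : Poly K (A ⊕ B)} {T : Poly K A ⊗[K] Poly K B}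
    (hP : Doubles P T) : Doubles (r • P) (r • T) := by
  rw [Doubles, map_smul, map_smul, hP]

theorem Doubles.prod_ofFn {n : ℕ} {P : Fin n → Poly K (A ⊕ B)}
    {T : Fin n → Poly K A ⊗[K] Poly K B} (h : ∀ i, Doubles (P i) (T i)) :
    Doubles (List.ofFn P).prod (List.ofFn T).prod := by
  induction n with
  | zero => simpa using Doubles.one
  | succ n ih =>
    rw [List.ofFn_succ, List.ofFn_succ, List.prod_cons, List.prod_cons]
    exact (h 0).mul (ih fun i => h i.succ)

end Theta

/-- Expansion of a noncommutative product of sums. -/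
theorem prod_ofFn_sum {R : Type*} [Ring R] {n : ℕ} {ι : Fin n → Type*} [∀ i, Fintype (ι i)]
    (f : (i : Fin n) → ι i → R) :
    (List.ofFn fun i => ∑ c, f i c).prod =
      ∑ c : (i : Fin n) → ι i, (List.ofFn fun i => f i (c i)).prod := by
  induction n with
  | zero => simp
  | succ n ih =>
    rw [List.ofFn_succ, List.prod_cons, ih, Finset.sum_mul_sum, ← Fintype.sum_prod_type',
      ← (Fin.consEquiv ι).sum_comp]
    refine Finset.sum_congr rfl fun p _ => ?_
    rw [List.ofFn_succ, List.prod_cons]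
    rfl

theorem tmul_prod_ofFn {K : Type*} [Field K] {R R' : Type*} [Ring R] [Ring R'] [Algebra K R]
    [Algebra K R'] {n : ℕ} (f : Fin n → R) (g : Fin n → R') :
    (List.ofFn fun i => f i ⊗ₜ[K] g i).prod = (List.ofFn f).prod ⊗ₜ (List.ofFn g).prod := by
  induction n with
  | zero => simp [Algebra.TensorProduct.one_def]
  | succ n ih => simp [List.ofFn_succ, ih]

/-! ### Factorizations of terms -/

/-- `finSigmaFinEquiv` orders pairs lexicographically; the leaves of a term are thus read subterm by
subterm. -/
theorem ofFn_eq_flatten {α : Type*} {m : ℕ} {n : Fin m → ℕ} (g : Fin (∑ i, n i) → α) :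
    List.ofFn g =
      (List.ofFn fun i => List.ofFn fun j : Fin (n i) => g (finSigmaFinEquiv ⟨i, j⟩)).flatten := by
  refine List.ext_getElem? fun k => ?_
  by_cases hk : k < ∑ i, n i
  · obtain ⟨⟨i, j⟩, h⟩ := finSigmaFinEquiv.surjective (⟨k, hk⟩ : Fin (∑ i, n i))
    have hk' : k = ∑ i' ∈ Finset.Iio i, n i' + j := by
      have h' := congrArg Fin.val h
      rw [finSigmaFinEquiv_apply] at h'
      rw [show k = _ from h'.symm]
      congr 1
      have : Finset.Iio i = Finset.univ.map (Fin.castLEEmb i.2.le) := by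
        ext x
        simp only [Finset.mem_Iio, Finset.mem_map, Finset.mem_univ, true_and]
        exact ⟨fun hx => ⟨⟨x, hx⟩, rfl⟩, by rintro ⟨y, rfl⟩; exact y.2⟩
      rw [this, Finset.sum_map]
      rfl
    have := getElem?_flatten_ofFn
      (fun i => List.ofFn fun j : Fin (n i) => g (finSigmaFinEquiv ⟨i, j⟩)) i j (by simp)
    simp only [List.length_ofFn] at this
    rw [← hk'] at this
    rw [this, List.getElem?_ofFn, List.getElem?_ofFn, dif_pos hk, dif_pos j.2, ← h]
  · rw [List.getElem?_eq_none (by simpa using hk), List.getElem?_eq_none]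
    rw [length_flatten_ofFn]
    simpa using hk

section Cut

variable {S : Signature.{u}}

/-- The factorizations `t = y[y₁, …, yₙ]` of a term. -/
abbrev Cut (t : STerm S) : Type u :=
  {p : (y : STerm S) × (Fin y.arity → STerm S) // p.1.graft p.2 = t}

/-- A factorization of a term given by the trivial factorization or by factorizations of the
subterms of the root. -/
def cutNode (s : S.carrier) (t : Fin (S.arity s) → STerm S) :
    Option ((k : Fin (S.arity s)) → Cut (t k)) → Cut (.node s t)
  | none => ⟨⟨.leaf, fun _ => .node s t⟩, rfl⟩
  | some c => ⟨⟨.node s fun k => (c k).1.1, fun k : Fin (∑ i, ((c i).1.1).arity) =>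
      (c (finSigmaFinEquiv.symm k).1).1.2 (finSigmaFinEquiv.symm k).2⟩, by
    refine congrArg (STerm.node s) (funext fun k => Eq.trans ?_ (c k).2)
    refine congrArg _ (funext fun j => ?_)
    change (c (finSigmaFinEquiv.symm
      (finSigmaFinEquiv (n := fun k => ((c k).1.1).arity) ⟨k, j⟩)).1).1.2 _ = _
    rw [finSigmaFinEquiv.symm_apply_apply]⟩

/-- In a factorization of `node s t`, the upper term is either the leaf, with the whole term grafted
on it, or a node that must be decorated by `s`; in the latter case each subterm is factorized
independently. -/
theorem cutNode_bijective (s : S.carrier) (t : Fin (S.arity s) → STerm S) :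
    Function.Bijective (cutNode s t) := by
  constructor
  · rintro (- | c) (- | c') h
    · rfl
    · have := congrArg (fun p => p.1.1) h
      cases this
    · have := congrArg (fun p => p.1.1) h
      cases this
    · congr 1
      have h' := congrArg Subtype.val h
      -- The upper terms are generalized to variables so that their equality can be substituted
      -- before comparing the grafted families, whose index types depend on them.
      have key : ∀ (y y' : Fin (S.arity s) → STerm S) (w : ∀ k, Fin (y k).arity → STerm S)
          (w' : ∀ k, Fin (y' k).arity → STerm S),
          (⟨.node s y, fun k : Fin (∑ i, (y i).arity) =>
            w (finSigmaFinEquiv.symm k).1 (finSigmaFinEquiv.symm k).2⟩ :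
              (y : STerm S) × (Fin y.arity → STerm S)) =
          ⟨.node s y', fun k : Fin (∑ i, (y' i).arity) =>
            w' (finSigmaFinEquiv.symm k).1 (finSigmaFinEquiv.symm k).2⟩ →
          ∀ k, (⟨y k, w k⟩ : (y : STerm S) × (Fin y.arity → STerm S)) = ⟨y' k, w' k⟩ := by
        intro y y' w w' h k
        obtain ⟨h1, h2⟩ := Sigma.mk.inj h
        obtain rfl : y = y' := by injection h1
        have h3 := eq_of_heq h2
        congr 1
        funext j
        have h4 := congrFun h3 (finSigmaFinEquiv ⟨k, j⟩)
        rw [finSigmaFinEquiv.symm_apply_apply] at h4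
        exact h4
      exact funext fun k => Subtype.ext (key _ _ (fun k => (c k).1.2) (fun k => (c' k).1.2) h' k)
  · rintro ⟨⟨y, w⟩, h⟩
    cases y with
    | leaf =>
      refine ⟨none, Subtype.ext ?_⟩
      change (⟨_, _⟩ : (y : STerm S) × (Fin y.arity → STerm S)) = _
      congr 1
      funext k
      obtain rfl : k = (0 : Fin 1) := Subsingleton.elim (α := Fin 1) _ _
      exact h.symm
    | node s' y =>
      change STerm.node s' _ = STerm.node s t at h
      obtain ⟨rfl, h⟩ := STerm.node.inj h
      obtain rfl := eq_of_heq h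
      refine ⟨some fun k => ⟨⟨y k, fun j => w (finSigmaFinEquiv ⟨k, j⟩)⟩, rfl⟩, Subtype.ext ?_⟩
      change (⟨_, _⟩ : (y : STerm S) × (Fin y.arity → STerm S)) = _
      congr 1
      funext k
      exact congrArg w (finSigmaFinEquiv.apply_symm_apply k)

instance subsingleton_cut_leaf : Subsingleton (Cut (.leaf : STerm S)) := by
  have : ∀ c : Cut (.leaf : STerm S), c.1 = ⟨.leaf, fun _ => .leaf⟩ := by
    rintro ⟨⟨y, w⟩, h⟩
    cases y with
    | leaf =>
      change (⟨_, _⟩ : (y : STerm S) × (Fin y.arity → STerm S)) = _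
      congr 1
      funext k
      obtain rfl : k = (0 : Fin 1) := Subsingleton.elim (α := Fin 1) _ _
      exact h
    | node s y => cases h
  exact ⟨fun c c' => Subtype.ext ((this c).trans (this c').symm)⟩

instance finite_cut (t : STerm S) : Finite (Cut t) := by
  induction t with
  | leaf => infer_instance
  | node s t ih => exact Finite.of_surjective _ (cutNode_bijective s t).2

instance fintypeCut (t : STerm S) : Fintype (Cut t) := Fintype.ofFinite _

end Cut

/-! ### Doubling of the alphabet -/

section Doubling

variable (K : Type v) [Field K] {S : Signature.{u}} (A B : ForestAlphabet S.carrier)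

/-- The disjoint sum of two forest-like alphabets. -/
abbrev sumAlphabet : ForestAlphabet S.carrier := (ForestAlphabet.sumRel S.carrier).sum A B

/-- The contribution of a factorization of a term to the image by `θ` of the sum of its
compatible words. -/
def cutTensor (P : A.carrier → Prop) (p : (y : STerm S) × (Fin y.arity → STerm S)) :
    Poly K A.carrier ⊗[K] Poly K B.carrier :=
  termSum K A P p.1 ⊗ₜ
    (List.ofFn fun k => termSum K B (ForestAlphabet.IsRoot B) (p.2 k)).prod

variable {K A B}

/-- The function on words vanishing on the empty word and with prescribed values on the other
words. -/
def onCons {α : Type u} (F : α → List α → K) : List α → K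
  | [] => 0
  | a :: u => F a u

/-- When the empty word has coefficient zero, `onCons` merges the four cases given by the emptiness
of `u` and `v` into one formula. -/
theorem thetaFun_eq_of_nil {α β : Type u} (f : List (α ⊕ β) → K) (hf : f [] = 0) (u : List α)
    (v : List β) :
    thetaFun f u v =
      onCons (fun a u' => thetaFun (fun w => f (.inl a :: w)) u' v) u +
      onCons (fun b v' => thetaFun (fun w => f (.inr b :: w)) u v') v := by
  obtain - | ⟨a, u⟩ := u <;> obtain - | ⟨b, v⟩ := v <;>
    simp [onCons, thetaFun_nil_nil, thetaFun_nil_cons, thetaFun_cons_nil, thetaFun_cons_cons, hf]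

theorem thetaFun_ite {α β : Type u} (f : List (α ⊕ β) → K) (Q : Prop) [Decidable Q]
    (u : List α) (v : List β) :
    thetaFun (fun w => if Q then f w else 0) u v = if Q then thetaFun f u v else 0 := by
  split_ifs
  · rfl
  · exact thetaFun_zero u v

open scoped Classical in
theorem termSum_node (P : A.carrier → Prop) (s : S.carrier) (t : Fin (S.arity s) → STerm S)
    (w : List A.carrier) :
    (termSum K A P (.node s t)).1 w =
      onCons (fun a w => if P a ∧ ForestAlphabet.IsDec A s a then
        ((List.ofFn fun k : Fin (S.arity s) => termSum K A
          (ForestAlphabet.IsEdge A k.val.succPNat a) (t k)).prod).1 w else 0) w := by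
  obtain - | ⟨a, w⟩ := w
  · exact termSum_node_nil K A P s t
  · exact termSum_node_cons K A P s t a w

open scoped Classical in
-- The first letter of a compatible word is that of the root; the two summands correspond to a root
-- letter in `A` or in `B`.
theorem theta_termSum_node (P : A.carrier ⊕ B.carrier → Prop) (s : S.carrier)
    (t : Fin (S.arity s) → STerm S) (u : List A.carrier) (v : List B.carrier) :
    theta K A.carrier B.carrier (termSum K (sumAlphabet A B) P (.node s t)) (u, v) =
      onCons (fun a u' => if P (.inl a) ∧ ForestAlphabet.IsDec A s a then
        theta K A.carrier B.carrier (List.ofFn fun k : Fin (S.arity s) =>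
          termSum K (sumAlphabet A B)
            (ForestAlphabet.IsEdge (sumAlphabet A B) k.val.succPNat (.inl a)) (t k)).prod (u', v)
        else 0) u +
      onCons (fun b v' => if P (.inr b) ∧ ForestAlphabet.IsDec B s b then
        theta K A.carrier B.carrier (List.ofFn fun k : Fin (S.arity s) =>
          termSum K (sumAlphabet A B)
            (ForestAlphabet.IsEdge (sumAlphabet A B) k.val.succPNat (.inr b)) (t k)).prod (u, v')
        else 0) v := by
  rw [theta_apply, thetaFun_eq_of_nil _ (termSum_node_nil _ _ _ _ _)]
  simp only [theta_apply]
  congr 1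
  · congr 1
    funext a u'
    exact (congrArg (fun f => thetaFun f u' v) (funext fun w =>
      termSum_node_cons K (sumAlphabet A B) P s t (.inl a) w)).trans (thetaFun_ite _ _ _ _)
  · congr 1
    funext b v'
    exact (congrArg (fun f => thetaFun f u v') (funext fun w =>
      termSum_node_cons K (sumAlphabet A B) P s t (.inr b) w)).trans (thetaFun_ite _ _ _ _)

theorem onCons_zero {α : Type u} (w : List α) : onCons (fun _ _ => (0 : K)) w = 0 := by
  cases w <;> rfl

theorem mul_onCons {α : Type u} (r : K) (F : α → List α → K) (w : List α) :
    r * onCons F w = onCons (fun a w => r * F a w) w := by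
  cases w <;> simp [onCons]

theorem sum_onCons_mul {ι : Type*} [Fintype ι] {α : Type u} (F : ι → α → List α → K) (r : ι → K)
    (w : List α) :
    ∑ i, onCons (F i) w * r i = onCons (fun a w => ∑ i, F i a w * r i) w := by
  cases w <;> simp [onCons]

open scoped Classical in
-- This evaluates the contribution of the root letters in `B`; the hypothesis expresses that below
-- such a letter everything stays in `B`.
theorem onCons_right_eq (Q : B.carrier → Prop) (s : S.carrier) (t : Fin (S.arity s) → STerm S)
    (h : ∀ b (k : Fin (S.arity s)), Doubles (termSum K (sumAlphabet A B)
      (ForestAlphabet.IsEdge (sumAlphabet A B) k.val.succPNat (.inr b)) (t k))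
      (1 ⊗ₜ termSum K B (ForestAlphabet.IsEdge B k.val.succPNat b) (t k)))
    (u : List A.carrier) (v : List B.carrier) :
    onCons (fun b v' => if Q b ∧ ForestAlphabet.IsDec B s b then
        theta K A.carrier B.carrier (List.ofFn fun k : Fin (S.arity s) =>
          termSum K (sumAlphabet A B)
            (ForestAlphabet.IsEdge (sumAlphabet A B) k.val.succPNat (.inr b)) (t k)).prod (u, v')
        else 0) v =
      toPairs K A.carrier B.carrier (1 ⊗ₜ termSum K B Q (.node s t)) (u, v) := by
  rw [toPairs_tmul, termSum_node, mul_onCons]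
  congr 1
  funext b v'
  rw [mul_ite, mul_zero, congrFun (Doubles.prod_ofFn (h b)) (u, v'), tmul_prod_ofFn, toPairs_tmul]
  simp only [List.ofFn_const, List.prod_replicate, one_pow]

/-- No edge of the sum leads from `B` to `A`, so a root letter in `B` forces all the letters into
`B`. The hypothesis on `P` is inherited by the subterms for the same reason. -/
theorem doubles_termSum_right (P : A.carrier ⊕ B.carrier → Prop) (hP : ∀ a, ¬ P (.inl a))
    (t : STerm S) :
    Doubles (termSum K (sumAlphabet A B) P t) (1 ⊗ₜ termSum K B (fun b => P (.inr b)) t) := by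
  classical
  induction t generalizing P with
  | leaf =>
    rw [termSum_leaf, termSum_leaf]
    exact Doubles.one
  | node s t ih =>
    funext ⟨u, v⟩
    rw [theta_termSum_node, onCons_right_eq (fun b => P (.inr b)) s t
      fun b k => ih k _ fun a h => h]
    simp only [hP, false_and, if_false, onCons_zero, zero_add]

/-- The letters of `A` occupy an upper part of the term, and every maximal subterm below it carries
letters of `B` with a root letter in the root relation. The assumption on `P` covers both the root
relation of the sum and the edges leaving a letter of `A`, which makes the induction close. -/
theorem doubles_termSum (P : A.carrier ⊕ B.carrier → Prop)
    (hP : ∀ b, P (.inr b) ↔ ForestAlphabet.IsRoot B b) (t : STerm S) :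
    Doubles (termSum K (sumAlphabet A B) P t)
      (∑ c : Cut t, cutTensor K A B (fun a => P (.inl a)) c.1) := by
  classical
  induction t generalizing P with
  | leaf =>
    rw [Fintype.sum_subsingleton _ (⟨⟨.leaf, fun _ => .leaf⟩, rfl⟩ : Cut (.leaf : STerm S)),
      cutTensor]
    simp only [termSum_leaf]
    simp only [List.ofFn_const, List.prod_replicate, one_pow]
    exact Doubles.one
  | node s t ih =>
    rw [← (cutNode_bijective s t).sum_comp, Fintype.sum_option]
    -- The trivial factorization accounts for the words entirely on `B`.
    have hnone : cutTensor K A B (fun a => P (.inl a)) (cutNode s t none).1 =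
        1 ⊗ₜ termSum K B (ForestAlphabet.IsRoot B) (.node s t) := by
      rw [cutTensor]
      change termSum K A _ .leaf ⊗ₜ (List.ofFn fun _ : Fin 1 => _).prod = _
      rw [termSum_leaf]
      congr 1
      exact List.prod_singleton
    -- The other factorizations have a root letter in `A`; their grafted terms are regrouped by
    -- subterm of the root.
    have hsome : ∀ c, cutTensor K A B (fun a => P (.inl a)) (cutNode s t (some c)).1 =
        termSum K A (fun a => P (.inl a)) (.node s fun k => (c k).1.1) ⊗ₜ
          (List.ofFn fun k => (List.ofFn fun j =>
            termSum K B (ForestAlphabet.IsRoot B) ((c k).1.2 j)).prod).prod := by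
      intro c
      rw [cutTensor]
      congr 1
      have := ofFn_eq_flatten (n := fun k => ((c k).1.1).arity)
        (fun k => termSum K B (ForestAlphabet.IsRoot B) ((cutNode s t (some c)).1.2 k))
      refine (congrArg List.prod this).trans ?_
      rw [List.prod_flatten, List.map_ofFn]
      congr 2
      funext k
      simp only [Function.comp_apply]
      congr 2
      funext j
      congr 1
      change (c (finSigmaFinEquiv.symm (finSigmaFinEquiv _)).1).1.2 _ = _
      rw [finSigmaFinEquiv.symm_apply_apply]
    rw [hnone, Finset.sum_congr rfl fun c _ => hsome c]
    funext ⟨u, v⟩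
    rw [theta_termSum_node, onCons_right_eq (fun b => P (.inr b)) s t
      fun b k => doubles_termSum_right _ (fun a h => h) _, map_add, Pi.add_apply, add_comm]
    simp only [hP]
    congr 1
    rw [map_sum, Finset.sum_apply]
    simp only [toPairs_tmul, termSum_node]
    rw [sum_onCons_mul]
    congr 1
    funext a u'
    -- By definition of the sum, an edge from a letter of `A` to a letter `b` of `B` means that `b`
    -- is a root, so the induction hypothesis applies to each subterm. Expanding the product of the
    -- sums over cuts gives the sum over families of cuts.
    have h2 := Doubles.prod_ofFn fun k : Fin (S.arity s) => ih k
      (ForestAlphabet.IsEdge (sumAlphabet A B) k.val.succPNat (.inl a)) (fun b => Iff.rfl)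
    rw [congrFun h2 (u', v), prod_ofFn_sum, map_sum, Finset.sum_apply]
    simp only [cutTensor, tmul_prod_ofFn, toPairs_tmul, ite_mul, zero_mul]
    split_ifs
    · rfl
    · rw [Finset.sum_const_zero]

end Doubling

/-! ### Quotients of free operads -/

section Quotient

variable {S : Signature.{u}}

theorem STerm.degree_graft (t : STerm S) (w : Fin t.arity → STerm S) :
    (t.graft w).degree = t.degree + ∑ i, (w i).degree := by
  induction t with
  | leaf =>
    rw [STerm.degree, zero_add]
    exact (Fin.sum_univ_one (fun i : Fin 1 => (w i).degree)).symm
  | node s t ih =>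
    change (STerm.node s _).degree = _ + ∑ k : Fin (∑ i, (t i).arity), (w k).degree
    rw [STerm.degree, STerm.degree, add_assoc, ← finSigmaFinEquiv.sum_comp, Fintype.sum_sigma,
      ← Finset.sum_add_distrib]
    exact congrArg _ (Finset.sum_congr rfl fun i _ => ih i _)

variable (c : (freeOperad S).Congruence)

theorem quotient_isGrading (hdeg : c.DegreeCompatible) :
    c.quotient.IsGrading (c.quotDegree hdeg) where
  eq_zero_iff x := by
    obtain ⟨t, rfl⟩ : ∃ t, c.proj t = x := ⟨_, c.proj_rep x⟩
    change t.degree = 0 ↔ c.proj t = c.proj .leaf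
    constructor
    · intro h
      rw [(STerm.degree_eq_zero_iff t).1 h]
    · intro h
      exact hdeg _ _ (c.proj_eq_iff.1 h)
  comp x y := by
    obtain ⟨x, y', rfl, h⟩ := c.exists_proj x y
    obtain rfl : y = fun i => c.proj (y' i) := funext h
    exact (congrArg (c.quotDegree hdeg) (c.quotComp_proj x y')).trans (STerm.degree_graft x y')

variable {c} (hfin : c.FiniteType)

variable (c) in
/-- The equivalence class of a term. -/
def termClass (t : STerm S) : c.quotient.carrier := c.proj t

theorem exists_termClass (x : c.quotient.carrier) : ∃ t, termClass c t = x :=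
  ⟨_, c.proj_rep x⟩

/-- The terms of an equivalence class. -/
def fiber (x : c.quotient.carrier) : Finset (STerm S) :=
  Set.Finite.toFinset (s := {t : STerm S | termClass c t = x}) (by
    obtain ⟨t, rfl⟩ := exists_termClass x
    exact (hfin t).subset fun t' ht' => c.proj_eq_iff.1 ht')

theorem mem_fiber {x : c.quotient.carrier} {t : STerm S} : t ∈ fiber hfin x ↔
    termClass c t = x := by
  rw [fiber, Set.Finite.mem_toFinset, Set.mem_ofPred_eq]

theorem fiber_unit (hdeg : c.DegreeCompatible) : fiber hfin c.quotient.unit = {.leaf} := by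
  ext t
  rw [mem_fiber, Finset.mem_singleton]
  constructor
  · intro h
    exact (STerm.degree_eq_zero_iff t).1 (hdeg _ _ (c.proj_eq_iff.1 h))
  · rintro rfl
    rfl

variable (c) in
/-- The projection of a factorization of a term. -/
def projFactor (p : (y : STerm S) × (Fin y.arity → STerm S)) :
    (y : c.quotient.carrier) × (Fin (c.quotient.arity y) → c.quotient.carrier) :=
  ⟨termClass c p.1, fun i => termClass c (p.2 i)⟩

theorem comp_projFactor (p : (y : STerm S) × (Fin y.arity → STerm S)) :
    c.quotient.comp (projFactor c p).1 (projFactor c p).2 = termClass c (p.1.graft p.2) :=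
  c.quotComp_proj p.1 p.2

theorem projFactor_surjective : Function.Surjective (projFactor c) := by
  rintro ⟨x, y⟩
  obtain ⟨x, y', rfl, h⟩ := c.exists_proj x y
  obtain rfl : y = fun i => c.proj (y' i) := funext h
  exact ⟨⟨x, y'⟩, rfl⟩

include hfin in
-- The class is finite and each of its terms has finitely many cuts.
theorem finite_factorizations (x : c.quotient.carrier) :
    {p : (y : STerm S) × (Fin y.arity → STerm S) | termClass c (p.1.graft p.2) = x}.Finite := by
  refine ((fiber hfin x).finite_toSet.biUnion fun t _ =>
    Set.finite_range fun q : Cut t => q.1).subset fun p hp => ?_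
  simp only [Set.mem_iUnion]
  exact ⟨p.1.graft p.2, (mem_fiber hfin).2 hp, ⟨p, rfl⟩, rfl⟩

include hfin in
-- Choosing representatives lifts every factorization in the quotient to a factorization of some
-- term of the class.
theorem quotient_finitelyFactorizable : c.quotient.FinitelyFactorizable := by
  intro x
  refine ((finite_factorizations hfin x).image (projFactor c)).subset fun q hq => ?_
  obtain ⟨p, rfl⟩ := projFactor_surjective q
  exact ⟨p, (comp_projFactor p).symm.trans hq, rfl⟩

theorem prod_ofFn_sum_finset {R : Type*} [Ring R] {n : ℕ} {α : Type*} (s : Fin n → Finset α)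
    (f : α → R) :
    (List.ofFn fun i => ∑ a ∈ s i, f a).prod =
      ∑ a ∈ Fintype.piFinset s, (List.ofFn fun i => f (a i)).prod := by
  classical
  have : (fun i => ∑ a ∈ s i, f a) = fun i => ∑ a : s i, f a :=
    funext fun i => (Finset.sum_coe_sort (s i) f).symm
  rw [this, prod_ofFn_sum]
  refine Finset.sum_bij (fun a _ i => (a i).1) (fun a _ => ?_) (fun a _ a' _ h => ?_)
    (fun a ha => ?_) fun a _ => rfl
  · exact Fintype.mem_piFinset.2 fun i => (a i).2
  · exact funext fun i => Subtype.ext (congrFun h i)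
  · exact ⟨fun i => ⟨a i, Fintype.mem_piFinset.1 ha i⟩, Finset.mem_univ _, rfl⟩

/-! ### Sums of compatible words over equivalence classes -/

variable (K : Type v) [Field K]

/-- The sum of the compatible words of the terms of an equivalence class. -/
def classSum (A : ForestAlphabet S.carrier) (x : c.quotient.carrier) : Poly K A.carrier :=
  ∑ t ∈ fiber hfin x, termSum K A (ForestAlphabet.IsRoot A) t

theorem classSum_unit (hdeg : c.DegreeCompatible) (A : ForestAlphabet S.carrier) :
    classSum hfin K A c.quotient.unit = 1 := by
  rw [classSum, fiber_unit hfin hdeg, Finset.sum_singleton, termSum_leaf]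

/-- With the upper term fixed, the grafted terms range independently over their classes, and the
noncommutative product of the class sums expands accordingly. -/
theorem sum_ofFn_fiber (B : ForestAlphabet S.carrier) (y : STerm S)
    (q : (y : c.quotient.carrier) × (Fin (c.quotient.arity y) → c.quotient.carrier))
    (h : termClass c y = q.1) (s : Finset (Fin y.arity → STerm S))
    (hs : ∀ w, w ∈ s ↔ projFactor c ⟨y, w⟩ = q) :
    ∑ w ∈ s, (List.ofFn fun k => termSum K B (ForestAlphabet.IsRoot B) (w k)).prod =
      (List.ofFn fun k => classSum hfin K B (q.2 k)).prod := by
  obtain ⟨Y, Ys⟩ := q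
  change termClass c y = Y at h
  -- After this substitution `Ys` is indexed by the leaves of `y` itself, and no transport along an
  -- equality of arities remains.
  subst h
  change Fin y.arity → c.quotient.carrier at Ys
  refine Eq.trans (Finset.sum_congr ?_ fun _ _ => rfl)
    (prod_ofFn_sum_finset (fun k => fiber hfin (Ys k)) _).symm
  ext w
  rw [hs, Fintype.mem_piFinset]
  simp only [mem_fiber]
  constructor
  · intro h
    exact congrFun (eq_of_heq (Sigma.mk.inj h).2)
  · intro h
    exact congrArg (Sigma.mk (termClass c y)) (funext h)

/-- The factorizations above `q` form a full product of classes: any representative of `q.1` can be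
combined with any representatives of the `q.2 k`. -/
theorem sum_cutTensor_projFactor (A B : ForestAlphabet S.carrier)
    (q : (y : c.quotient.carrier) × (Fin (c.quotient.arity y) → c.quotient.carrier))
    (s : Finset ((y : STerm S) × (Fin y.arity → STerm S)))
    (hs : ∀ p, p ∈ s ↔ projFactor c p = q) :
    ∑ p ∈ s, cutTensor K A B (ForestAlphabet.IsRoot A) p =
      classSum hfin K A q.1 ⊗ₜ (List.ofFn fun k => classSum hfin K B (q.2 k)).prod := by
  classical
  have hs' : s = (fiber hfin q.1).sigma fun y =>
      s.preimage (Sigma.mk y) sigma_mk_injective.injOn := by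
    ext ⟨y, w⟩
    rw [Finset.mem_sigma, Finset.mem_preimage, mem_fiber, hs]
    exact ⟨fun h => ⟨congrArg Sigma.fst h, h⟩, fun h => h.2⟩
  rw [hs', Finset.sum_sigma, classSum, TensorProduct.sum_tmul]
  refine Finset.sum_congr rfl fun y hy => ?_
  simp only [cutTensor]
  rw [← TensorProduct.tmul_sum, sum_ofFn_fiber hfin K B y q ((mem_fiber hfin).1 hy)]
  intro w
  rw [Finset.mem_preimage, hs]

/-- Double counting: a term of the class `x` with a cut is the same as a factorization whose
composite lies in `x`, and such factorizations are then grouped by their projections. -/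
theorem sum_cutTensor_fiber (A B : ForestAlphabet S.carrier) (x : c.quotient.carrier) :
    ∑ t ∈ fiber hfin x, ∑ p : Cut t, cutTensor K A B (ForestAlphabet.IsRoot A) p.1 =
      ∑ q ∈ (quotient_finitelyFactorizable hfin x).toFinset,
        classSum hfin K A q.1 ⊗ₜ (List.ofFn fun k => classSum hfin K B (q.2 k)).prod := by
  classical
  have h1 : ∑ t ∈ fiber hfin x, ∑ p : Cut t, cutTensor K A B (ForestAlphabet.IsRoot A) p.1 =
      ∑ p ∈ (finite_factorizations hfin x).toFinset,
        cutTensor K A B (ForestAlphabet.IsRoot A) p := by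
    rw [← Finset.sum_fiberwise_of_maps_to (t := fiber hfin x) 
      (g := fun p : (y : STerm S) × (Fin y.arity → STerm S) => p.1.graft p.2)]
    · refine Finset.sum_congr rfl fun t ht => ?_
      rw [mem_fiber] at ht
      refine (Finset.sum_subtype _ (fun p => ?_) _).symm
      rw [Finset.mem_filter, Set.Finite.mem_toFinset]
      exact ⟨fun h => h.2, fun h => ⟨by rw [Set.mem_ofPred_eq, h, ht], h⟩⟩
    · intro p hp
      exact (mem_fiber hfin).2 ((Set.Finite.mem_toFinset (finite_factorizations hfin x)).1 hp)
  rw [h1, ← Finset.sum_fiberwise_of_maps_to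
    (t := (quotient_finitelyFactorizable hfin x).toFinset) (g := projFactor c)]
  · refine Finset.sum_congr rfl fun q hq => sum_cutTensor_projFactor hfin K A B q _ fun p => ?_
    rw [Finset.mem_filter, Set.Finite.mem_toFinset]
    rw [Set.Finite.mem_toFinset] at hq
    refine ⟨fun h => h.2, fun h => ⟨?_, h⟩⟩
    rw [Set.mem_ofPred_eq, ← comp_projFactor, h]
    exact hq
  · intro p hp
    rw [Set.Finite.mem_toFinset] at hp ⊢
    exact (comp_projFactor p).trans hp

theorem doubles_classSum (A B : ForestAlphabet S.carrier) (x : c.quotient.carrier) :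
    Doubles (classSum hfin K (sumAlphabet A B) x)
      (∑ q ∈ (quotient_finitelyFactorizable hfin x).toFinset,
        classSum hfin K A q.1 ⊗ₜ (List.ofFn fun k => classSum hfin K B (q.2 k)).prod) := by
  rw [← sum_cutTensor_fiber]
  exact Doubles.sum fun t _ => doubles_termSum _ (fun _ => Iff.rfl) t

/-! ### The realizing maps as algebra morphisms -/

section Elem

variable {O : Operad.{u}}

theorem elem_one : elem K (1 : O.RWord) = 1 := rfl

theorem elem_mul (w w' : O.RWord) : elem K (w * w') = elem K w * elem K w' := by
  rw [elem, elem, elem, MonoidAlgebra.single_mul_single, one_mul]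

theorem natLift_elem {M : Type*} [AddCommGroup M] [Module K M] (g : O.RWord → M) (w : O.RWord) :
    natLift K O g (elem K w) = g w := by
  simp [natLift, elem, MonoidAlgebra.coeffLinearEquiv]

theorem natAlg_hom_ext {M : Type*} [AddCommGroup M] [Module K M] {f g : NatAlg K O →ₗ[K] M}
    (h : ∀ w, f (elem K w) = g (elem K w)) : f = g :=
  MonoidAlgebra.lhom_ext' fun w => LinearMap.ext_ring (h w)

theorem rd_nil : O.rd [] = 1 := rfl

theorem rd_unit_cons (l : List O.carrier) : O.rd (O.unit :: l) = O.rd l := by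
  simp [Operad.rd]

theorem rd_cons {x : O.carrier} (hx : x ≠ O.unit) (l : List O.carrier) :
    O.rd (x :: l) = FreeMonoid.of ⟨x, hx⟩ * O.rd l := by
  simp [Operad.rd, hx]

theorem comul_of (hO : O.FinitelyFactorizable) (x : O.NonUnit) :
    comul K O (elem K (FreeMonoid.of x)) = ∑ q ∈ (hO x.1).toFinset,
      elem K (O.rd [q.1]) ⊗ₜ[K] elem K (O.rd (List.ofFn q.2)) := by
  rw [comul, elem, MonoidAlgebra.lift_single, one_smul, FreeMonoid.lift_eval_of]
  exact finsum_mem_eq_finite_toFinset_sum _ (hO x.1)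

theorem counit_of (x : O.NonUnit) : counit K O (elem K (FreeMonoid.of x)) = 0 := by
  rw [counit, elem, MonoidAlgebra.lift_single, one_smul, FreeMonoid.lift_eval_of]

end Elem

/-- The realizing map of the quotient operad, as an algebra morphism. -/
def realizeHom (A : ForestAlphabet S.carrier) : NatAlg K c.quotient →ₐ[K] Poly K A.carrier :=
  MonoidAlgebra.lift K _ _ (FreeMonoid.lift fun x => classSum hfin K A x.1)

theorem realizeHom_of (A : ForestAlphabet S.carrier) (x : c.quotient.NonUnit) :
    realizeHom hfin K A (elem K (FreeMonoid.of x)) = classSum hfin K A x.1 := by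
  rw [realizeHom, elem, MonoidAlgebra.lift_single, one_smul, FreeMonoid.lift_eval_of]

/-- Deleting unit letters is harmless because the class of the leaf contains only the leaf, whose
sum is 1. -/
theorem realizeHom_rd (hdeg : c.DegreeCompatible) (A : ForestAlphabet S.carrier)
    (l : List c.quotient.carrier) :
    realizeHom hfin K A (elem K (c.quotient.rd l)) = (l.map (classSum hfin K A)).prod := by
  induction l with
  | nil => rw [rd_nil, elem_one, map_one]; rfl
  | cons x l ih =>
    rw [List.map_cons, List.prod_cons, ← ih]
    by_cases hx : x = c.quotient.unit
    · rw [hx, rd_unit_cons, classSum_unit hfin K hdeg, one_mul]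
    · rw [rd_cons hx, elem_mul, map_mul, realizeHom_of]

/-- The embedding `(t, f) ↦ t :: f`. -/
def consEmbedding : STerm S × Forest S ↪ Forest S where
  toFun p := p.1 :: p.2
  inj' := by
    rintro ⟨t, f⟩ ⟨t', f'⟩ h
    obtain ⟨rfl, rfl⟩ := List.cons.inj h
    rfl

theorem consEmbedding_apply (t : STerm S) (f : Forest S) : consEmbedding (t, f) = t :: f := rfl

/-- The forests that project letter by letter onto a word. -/
def lifts : List c.quotient.carrier → Finset (Forest S)
  | [] => {[]}
  | x :: l => (fiber hfin x ×ˢ lifts l).map consEmbedding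

theorem mem_lifts {l : List c.quotient.carrier} {f : Forest S} :
    f ∈ lifts hfin l ↔ f.map (termClass c) = l := by
  induction l generalizing f with
  | nil => simp [lifts]
  | cons x l ih =>
    obtain - | ⟨t, f⟩ := f
    · simp [lifts, consEmbedding_apply]
    · simp only [lifts, Finset.mem_map, Finset.mem_product, mem_fiber, ih,
        consEmbedding_apply, List.map_cons, List.cons.injEq, Prod.exists]
      constructor
      · rintro ⟨t', f', ⟨h1, h2⟩, rfl, rfl⟩
        exact ⟨h1, h2⟩
      · rintro ⟨h1, h2⟩
        exact ⟨t, f, ⟨h1, h2⟩, rfl, rfl⟩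

theorem sum_lifts_compatibleSum (A : ForestAlphabet S.carrier) (l : List c.quotient.carrier) :
    ∑ f ∈ lifts hfin l, compatibleSum K A f = (l.map (classSum hfin K A)).prod := by
  induction l with
  | nil => simp [lifts, compatibleSum_nil]
  | cons x l ih =>
    rw [lifts, Finset.sum_map, Finset.sum_product, List.map_cons, List.prod_cons, ← ih, classSum,
      Finset.sum_mul_sum]
    simp only [consEmbedding_apply, compatibleSum_cons]

theorem RWord.word_injective {O : Operad.{u}} : Function.Injective (Operad.RWord.word (O := O)) :=
  fun _ _ h => (List.map_injective_iff.2 Subtype.val_injective) h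

theorem RWord.exists_word {O : Operad.{u}} (l : List O.carrier) (hl : ∀ x ∈ l, x ≠ O.unit) :
    ∃ w : O.RWord, w.word = l :=
  ⟨FreeMonoid.ofList (l.attach.map fun x => ⟨x.1, hl x.1 x.2⟩), by
    simp [Operad.RWord.word]⟩

theorem quotientRealize_elem (A : ForestAlphabet S.carrier) (w : c.quotient.RWord) :
    quotientRealize K c A (elem K w) = ∑ f ∈ lifts hfin w.word, compatibleSum K A f := by
  have hf : {f : (freeOperad S).RWord | f.word.map (termClass c) = w.word}.Finite := by
    refine ((lifts hfin w.word).finite_toSet.preimage RWord.word_injective.injOn).subset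
      fun f hf => ?_
    exact (mem_lifts hfin).2 hf
  have h1 : quotientMap K c (elem K w) = ∑ f ∈ hf.toFinset, elem K f := by
    rw [quotientMap, natLift_elem]
    exact finsum_mem_eq_finite_toFinset_sum _ hf
  rw [quotientRealize, LinearMap.comp_apply, h1, map_sum]
  refine Finset.sum_bij (fun f _ => f.word) (fun f hf' => ?_) (fun f _ g _ h =>
    RWord.word_injective h) (fun f hf' => ?_) fun f _ => ?_
  · exact (mem_lifts hfin).2 ((Set.Finite.mem_toFinset hf).1 hf')
  · rw [mem_lifts] at hf'
    -- A lift of a reduced word is reduced: the class of the leaf is the unit, which is not a letter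
    -- of `w`.
    obtain ⟨g, rfl⟩ := RWord.exists_word (O := freeOperad S) f fun t ht h => by
      have h2 : termClass c t ∈ w.word := by
        rw [← hf']
        exact List.mem_map_of_mem ht
      obtain ⟨x, -, hx⟩ := List.mem_map.1 h2
      exact x.2 (by rw [hx, h]; rfl)
    exact ⟨g, (Set.Finite.mem_toFinset hf).2 hf', rfl⟩
  · rw [realize, natLift_elem]

theorem realizeHom_elem (A : ForestAlphabet S.carrier) (w : c.quotient.RWord) :
    realizeHom hfin K A (elem K w) = (w.word.map (classSum hfin K A)).prod := by
  rw [realizeHom, elem, MonoidAlgebra.lift_single, one_smul, FreeMonoid.lift_apply,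
    Operad.RWord.word, List.map_map]
  rfl

/-- The forests above a word are obtained by lifting its letters independently, so the sum of their
compatible words factors over the letters. Multiplicativity of the realizing map follows. -/
theorem quotientRealize_eq (A : ForestAlphabet S.carrier) :
    quotientRealize K c A = (realizeHom hfin K A).toLinearMap := by
  refine natAlg_hom_ext K fun w => ?_
  rw [quotientRealize_elem hfin, AlgHom.toLinearMap_apply, realizeHom_elem,
    sum_lifts_compatibleSum]

/-- Both sides are linear and multiplicative, which reduces the identity to the generators, treated
by `doubles_classSum`. -/
theorem doubles_realizeHom (hdeg : c.DegreeCompatible) (A B : ForestAlphabet S.carrier)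
    (x : NatAlg K c.quotient) :
    Doubles (realizeHom hfin K (sumAlphabet A B) x)
      (Algebra.TensorProduct.map (realizeHom hfin K A) (realizeHom hfin K B)
        (comul K c.quotient x)) := by
  induction x using MonoidAlgebra.induction_linear with
  | zero => rw [map_zero, map_zero, map_zero, Doubles, map_zero, map_zero]
  | add x y hx hy =>
    rw [map_add, map_add, map_add]
    exact hx.add hy
  | single w r =>
    have h : MonoidAlgebra.single w r = r • elem K w := by simp [elem]
    rw [h, map_smul, map_smul, map_smul]
    refine Doubles.smul r ?_
    clear h
    induction w using FreeMonoid.inductionOn' with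
    | one =>
      rw [elem_one, map_one, map_one, map_one]
      exact Doubles.one
    | of_mul x w ih =>
      rw [elem_mul, map_mul, map_mul, map_mul]
      refine Doubles.mul ?_ ih
      rw [comul_of K (quotient_finitelyFactorizable hfin), map_sum, realizeHom_of]
      refine Eq.subst (motive := Doubles _) (Finset.sum_congr rfl fun q _ => ?_)
        (doubles_classSum hfin K A B x.1)
      rw [Algebra.TensorProduct.map_tmul, realizeHom_rd hfin K hdeg, realizeHom_rd hfin K hdeg,
        List.map_singleton, List.prod_singleton, List.map_ofFn]
      rfl

end Quotient

/-! ### Injectivity on the alphabet of positions -/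

theorem filter_flatten_ofFn {α : Type*} {n : ℕ} (ws : Fin n → List α) (q : α → Bool) (k : Fin n)
    (hk : ∀ b ∈ ws k, q b) (hk' : ∀ k', k' ≠ k → ∀ b ∈ ws k', ¬ q b) :
    (List.ofFn ws).flatten.filter q = ws k := by
  induction n with
  | zero => exact k.elim0
  | succ n ih =>
    rw [List.ofFn_succ, List.flatten_cons, List.filter_append]
    cases k using Fin.cases with
    | zero =>
      rw [List.filter_eq_self.2 hk, List.filter_eq_nil_iff.2, List.append_nil]
      intro b hb
      obtain ⟨l, hl, hb⟩ := List.mem_flatten.1 hb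
      obtain ⟨i, rfl⟩ := (List.mem_ofFn' _ _).1 hl
      exact hk' i.succ (Fin.succ_ne_zero i) b hb
    | succ k =>
      rw [List.filter_eq_nil_iff.2 (hk' 0 (Fin.succ_ne_zero k).symm), List.nil_append]
      exact ih (fun k => ws k.succ) k hk fun k' h => hk' k'.succ (by simpa using h)

section Positions

variable {S : Signature.{u}}

/-- The letters of the alphabet of positions. -/
abbrev Pos (S : Signature.{u}) : Type u := (ForestAlphabet.positions S.carrier).carrier

/-- The letter `a^s_u`. -/
def mkPos (s : S.carrier) (u : List ℕ) : Pos S := (s, u)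

/-- The path from the root encoded by a position. -/
def posPath (a : Pos S) : List ℕ := (Prod.snd (α := S.carrier) (β := List ℕ) a).filter (· ≠ 0)

theorem posPath_of_isRoot {a : Pos S}
    (h : ForestAlphabet.IsRoot (ForestAlphabet.positions S.carrier) a) : posPath a = [] := by
  obtain ⟨l, hl⟩ := h
  change Prod.snd (α := S.carrier) (β := List ℕ) a = _ at hl
  simp [posPath, hl]

/-- The index `j` is positive, so it survives the deletion of the zeros, while the padding
disappears. -/
theorem posPath_of_isEdge {j : ℕ+} {a a' : Pos S}
    (h : ForestAlphabet.IsEdge (ForestAlphabet.positions S.carrier) j a a') :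
    posPath a' = posPath a ++ [(j : ℕ)] := by
  obtain ⟨l, hl⟩ := h
  change Prod.snd (α := S.carrier) (β := List ℕ) a' =
    Prod.snd (α := S.carrier) (β := List ℕ) a ++ _ ++ _ at hl
  simp [posPath, hl]

theorem TermWord.posPath_isPrefix {t : STerm S} {P : Pos S → Prop}
    {w : List (Pos S)} {p : List ℕ}
    (h : TermWord (ForestAlphabet.positions S.carrier) t P w) (hP : ∀ a, P a → posPath a = p) :
    ∀ b ∈ w, p <+: posPath b := by
  induction t generalizing P w p with
  | leaf =>
    rw [TermWord] at h
    simp [h]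
  | node s t ih =>
    rw [TermWord] at h
    obtain ⟨a, ws, rfl, ha, -, h⟩ := h
    intro b hb
    obtain rfl | hb := List.mem_cons.1 hb
    · rw [hP _ ha]
    · obtain ⟨l, hl, hb⟩ := List.mem_flatten.1 hb
      obtain ⟨k, rfl⟩ := (List.mem_ofFn' _ _).1 hl
      refine (List.prefix_append p [_]).trans
        (ih k (p := p ++ [(k.val.succPNat : ℕ)]) (h k) (fun a' ha' => ?_) b hb)
      rw [posPath_of_isEdge ha', hP _ ha]

theorem not_isPrefix_of_ne {p q : List ℕ} {i j : ℕ} (h : p ++ [i] <+: q) (hij : i ≠ j) :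
    ¬ p ++ [j] <+: q := by
  intro h'
  have := List.prefix_of_prefix_length_le h h' (by simp)
  have := this.eq_of_length (by simp)
  simp at this
  exact hij this

/-- Letters below the `k`-th child have a path extending that of the root by `k + 1`, and these
prefixes exclude one another. The blocks can thus be read from the word without knowing the term. -/
theorem TermWord.eq_filter {s : S.carrier} {t : Fin (S.arity s) → STerm S}
    {a : Pos S} {ws : Fin (S.arity s) → List (Pos S)}
    (h : ∀ k, TermWord (ForestAlphabet.positions S.carrier) (t k)
      (ForestAlphabet.IsEdge (ForestAlphabet.positions S.carrier) k.val.succPNat a) (ws k))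
    (k : Fin (S.arity s)) :
    (List.ofFn ws).flatten.filter
      (fun b => decide (posPath a ++ [k.val + 1] <+: posPath b)) = ws k := by
  have hp : ∀ k, ∀ b ∈ ws k, posPath a ++ [k.val + 1] <+: posPath b := fun k =>
    (h k).posPath_isPrefix fun a' ha' => posPath_of_isEdge ha'
  refine filter_flatten_ofFn _ _ k (fun b hb => by simpa using hp k b hb) fun k' hk b hb => ?_
  simpa using not_isPrefix_of_ne (hp k' b hb) (fun h => hk (Fin.ext (by omega)))

/-- The first letter gives the decoration of the root, and filtering by paths gives the words of the
subterms; the conditions on the root letter play no role. -/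
theorem TermWord.unique {t t' : STerm S} {P P' : Pos S → Prop}
    {w : List (Pos S)} (h : TermWord (ForestAlphabet.positions S.carrier) t P w)
    (h' : TermWord (ForestAlphabet.positions S.carrier) t' P' w) : t = t' := by
  induction t generalizing t' P P' w with
  | leaf =>
    cases t' with
    | leaf => rfl
    | node s' t' =>
      rw [TermWord] at h
      rw [TermWord] at h'
      obtain ⟨a, ws, hw, -⟩ := h'
      simp [h] at hw
  | node s t ih =>
    cases t' with
    | leaf =>
      rw [TermWord] at h
      rw [TermWord] at h'
      obtain ⟨a, ws, hw, -⟩ := h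
      simp [h'] at hw
    | node s' t' =>
      rw [TermWord] at h
      rw [TermWord] at h'
      obtain ⟨a, ws, rfl, -, hs, h⟩ := h
      obtain ⟨a', ws', hw, -, hs', h'⟩ := h'
      obtain ⟨rfl, hw'⟩ := List.cons.inj hw
      obtain rfl : s = s' := Eq.trans (Eq.symm hs) hs'
      congr 1
      funext k
      have hk : ws k = ws' k := by
        rw [← TermWord.eq_filter h k, hw', TermWord.eq_filter h' k]
      exact ih k (h k) (hk ▸ h' k)

/-- Only the root letter has an empty path, so empty paths mark where the terms of a forest begin.
-/
theorem TermWord.exists_cons {t : STerm S} (ht : t ≠ .leaf)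
    {w : List (Pos S)}
    (h : TermWord (ForestAlphabet.positions S.carrier) t
      (ForestAlphabet.IsRoot (ForestAlphabet.positions S.carrier)) w) :
    ∃ a r, w = a :: r ∧ posPath a = [] ∧ ∀ b ∈ r, posPath b ≠ [] := by
  cases t with
  | leaf => exact absurd rfl ht
  | node s t =>
    rw [TermWord] at h
    obtain ⟨a, ws, rfl, ha, -, h⟩ := h
    refine ⟨a, _, rfl, posPath_of_isRoot ha, fun b hb => ?_⟩
    obtain ⟨l, hl, hb⟩ := List.mem_flatten.1 hb
    obtain ⟨k, rfl⟩ := (List.mem_ofFn' _ _).1 hl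
    have := (h k).posPath_isPrefix (fun a' ha' => posPath_of_isEdge ha') b hb
    intro h0
    rw [h0] at this
    simp at this

theorem ForestWord.takeWhile_eq_nil {f : Forest S} (hf : ∀ t ∈ f, t ≠ .leaf)
    {w : List (Pos S)}
    (h : ForestWord (ForestAlphabet.positions S.carrier) f w) :
    w.takeWhile (fun b => decide (posPath b ≠ [])) = [] := by
  cases f with
  | nil =>
    rw [ForestWord] at h
    rw [h]
    rfl
  | cons t f =>
    rw [ForestWord] at h
    obtain ⟨w₁, w₂, rfl, h₁, -⟩ := h
    obtain ⟨a, r, rfl, ha, -⟩ := h₁.exists_cons (hf t List.mem_cons_self)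
    rw [List.cons_append]
    exact List.takeWhile_cons_of_neg (by simp [ha])

theorem ForestWord.unique {f g : Forest S} (hf : ∀ t ∈ f, t ≠ .leaf) (hg : ∀ t ∈ g, t ≠ .leaf)
    {w : List (Pos S)}
    (h : ForestWord (ForestAlphabet.positions S.carrier) f w)
    (h' : ForestWord (ForestAlphabet.positions S.carrier) g w) : f = g := by
  induction f generalizing g w with
  | nil =>
    rw [ForestWord] at h
    subst h
    cases g with
    | nil => rfl
    | cons t g =>
      rw [ForestWord] at h'
      obtain ⟨w₁, w₂, hw, h₁, -⟩ := h'
      obtain ⟨a, r, rfl, -⟩ := h₁.exists_cons (hg t List.mem_cons_self)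
      simp at hw
  | cons t f ih =>
    rw [ForestWord] at h
    obtain ⟨w₁, w₂, rfl, h₁, h₂⟩ := h
    obtain ⟨a, r, rfl, -, hr⟩ := h₁.exists_cons (hf t List.mem_cons_self)
    cases g with
    | nil =>
      rw [ForestWord] at h'
      simp at h'
    | cons t' g =>
      rw [ForestWord] at h'
      obtain ⟨w₁', w₂', hw, h₁', h₂'⟩ := h'
      obtain ⟨a', r', rfl, -, hr'⟩ := h₁'.exists_cons (hg t' List.mem_cons_self)
      have hf' : ∀ t ∈ f, t ≠ .leaf := fun t ht => hf t (List.mem_cons_of_mem _ ht)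
      have hg' : ∀ t ∈ g, t ≠ .leaf := fun t ht => hg t (List.mem_cons_of_mem _ ht)
      rw [List.cons_append, List.cons_append] at hw
      obtain ⟨rfl, hw'⟩ := List.cons.inj hw
      -- The word of the first term extends up to the next letter with an empty path, or to the end.
      have e : r = r' := by
        have := congrArg (List.takeWhile fun b => decide (posPath b ≠ [])) hw'
        rwa [List.takeWhile_append_of_pos (by simpa using hr),
          List.takeWhile_append_of_pos (by simpa using hr'), h₂.takeWhile_eq_nil hf',
          h₂'.takeWhile_eq_nil hg', List.append_nil, List.append_nil] at this
      subst e
      obtain rfl := List.append_cancel_left hw'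
      rw [h₁.unique h₁', ih hf' hg' h₂ h₂']

/-- Each node receives its actual path as position, with no padding by zeros, that is, with `ℓ = 0`
in the relations. -/
theorem exists_termWord (t : STerm S) (P : Pos S → Prop) (u : List ℕ)
    (hP : ∀ s, P (mkPos s u)) : ∃ w, TermWord (ForestAlphabet.positions S.carrier) t P w := by
  induction t generalizing P u with
  | leaf => exact ⟨[], by rw [TermWord]⟩
  | node s t ih =>
    have := fun k : Fin (S.arity s) => ih k (ForestAlphabet.IsEdge
      (ForestAlphabet.positions S.carrier) k.val.succPNat (mkPos s u))
      (u ++ [k.val + 1]) fun s' => ⟨0, by simp [mkPos]⟩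
    choose ws hws using this
    refine ⟨mkPos s u :: (List.ofFn ws).flatten, ?_⟩
    rw [TermWord]
    exact ⟨mkPos s u, ws, rfl, hP s, rfl, hws⟩

theorem exists_forestWord (f : Forest S) :
    ∃ w, ForestWord (ForestAlphabet.positions S.carrier) f w := by
  induction f with
  | nil => exact ⟨[], by rw [ForestWord]⟩
  | cons t f ih =>
    obtain ⟨w₂, h₂⟩ := ih
    obtain ⟨w₁, h₁⟩ := exists_termWord t
      (ForestAlphabet.IsRoot (ForestAlphabet.positions S.carrier)) [] fun s => ⟨0, by simp [mkPos]⟩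
    refine ⟨w₁ ++ w₂, ?_⟩
    rw [ForestWord]
    exact ⟨w₁, w₂, rfl, h₁, h₂⟩

variable {c : (freeOperad S).Congruence} (hfin : c.FiniteType) (K : Type v) [Field K]

theorem ne_leaf_of_mem_lifts {w : c.quotient.RWord} {f : Forest S} (hf : f ∈ lifts hfin w.word) :
    ∀ t ∈ f, t ≠ .leaf := by
  rintro _ ht rfl
  rw [mem_lifts] at hf
  have h2 : termClass c .leaf ∈ w.word := by
    rw [← hf]
    exact List.mem_map_of_mem ht
  obtain ⟨x, -, hx⟩ := List.mem_map.1 h2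
  exact x.2 hx

include hfin in
-- Choose a forest above `w₀` and a word `m` compatible with it. No other reduced forest is
-- compatible with `m`, so `m` occurs in the realization of a basis element only when the word
-- indexing it is `w₀`.
theorem exists_coeff_eq (w₀ : c.quotient.RWord) :
    ∃ m : List (Pos S), ∀ x : NatAlg K c.quotient,
      (quotientRealize K c (ForestAlphabet.positions S.carrier) x).1 m = x.coeff w₀ := by
  classical
  obtain ⟨f₀, hf₀⟩ : ∃ f₀, f₀ ∈ lifts hfin w₀.word := by
    choose r hr using exists_termClass (c := c)
    refine ⟨w₀.word.map r, (mem_lifts hfin).2 ?_⟩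
    rw [List.map_map]
    exact (List.map_congr_left fun x _ => hr x).trans (List.map_id _)
  obtain ⟨m, hm⟩ := exists_forestWord f₀
  refine ⟨m, fun x => ?_⟩
  let ev : Poly K (ForestAlphabet.positions S.carrier).carrier →ₗ[K] K :=
    LinearMap.proj m ∘ₗ (polySubmodule K _).subtype
  let co : NatAlg K c.quotient →ₗ[K] K :=
    Finsupp.lapply w₀ ∘ₗ (MonoidAlgebra.coeffLinearEquiv K).toLinearMap
  have : ev ∘ₗ quotientRealize K c (ForestAlphabet.positions S.carrier) = co := by
    refine natAlg_hom_ext K fun w => ?_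
    rw [LinearMap.comp_apply, quotientRealize_elem hfin, map_sum]
    have h1 : ∀ f ∈ lifts hfin w.word,
        ev (compatibleSum K (ForestAlphabet.positions S.carrier) f) =
          if f = f₀ then 1 else 0 := by
      intro f hf
      refine if_congr ?_ rfl rfl
      rw [compatible_iff]
      constructor
      · intro h
        exact h.unique (ne_leaf_of_mem_lifts hfin hf) (ne_leaf_of_mem_lifts hfin hf₀) hm
      · rintro rfl
        exact hm
    have h2 : co (elem K w) = if w = w₀ then 1 else 0 := by
      change (Finsupp.single w (1 : K)) w₀ = _
      rw [Finsupp.single_apply]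
    rw [Finset.sum_congr rfl h1, h2, Finset.sum_ite_eq']
    refine if_congr ?_ rfl rfl
    rw [mem_lifts] at hf₀ ⊢
    rw [hf₀, RWord.word_injective.eq_iff, eq_comm]
  exact LinearMap.congr_fun this x

include hfin in
theorem quotientRealize_positions_injective :
    Function.Injective (quotientRealize K c (ForestAlphabet.positions S.carrier)) := by
  intro x y h
  have : x.coeff = y.coeff := Finsupp.ext fun w => by
    obtain ⟨m, hm⟩ := exists_coeff_eq hfin K w
    rw [← hm, ← hm, h]
  cases x
  cases y
  exact congrArg _ this

end Positions

/-! ### Antipodes of graded connected bialgebras -/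

section Antipode

variable {K H ι : Type*} [Field K] [Ring H] [Algebra K H] [Coalgebra K H]

/-- The convolution product of two pairs of linear maps that agree on the basis elements of
degree at most `n` agree on these elements. -/
theorem convMul_congr (b : Module.Basis ι K H) (deg : ι → ℕ)
    (hΔ : ∀ i, Coalgebra.comul (R := K) (b i) ∈
      Submodule.span K {x | ∃ j k, deg j + deg k = deg i ∧ x = b j ⊗ₜ[K] b k})
    (f f' g g' : WithConv (H →ₗ[K] H)) (i : ι)
    (h : ∀ j k, deg j + deg k = deg i →
      f.ofConv (b j) * g.ofConv (b k) = f'.ofConv (b j) * g'.ofConv (b k)) :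
    (f * g).ofConv (b i) = (f' * g').ofConv (b i) := by
  have key : ∀ x ∈ Submodule.span K {x | ∃ j k, deg j + deg k = deg i ∧ x = b j ⊗ₜ[K] b k},
      LinearMap.mul' K H (TensorProduct.map f.ofConv g.ofConv x) =
        LinearMap.mul' K H (TensorProduct.map f'.ofConv g'.ofConv x) := by
    intro x hx
    induction hx using Submodule.span_induction with
    | mem x hx =>
      obtain ⟨j, k, hjk, rfl⟩ := hx
      simpa using h j k hjk
    | zero => simp
    | add x y _ _ hx hy => simp only [map_add, hx, hy]
    | smul r x _ hx => simp only [map_smul, hx]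
  exact key _ (hΔ i)

/-- The identity is `1 - J` for convolution, with `J` zero in degree zero. As the coproduct respects
degrees, `J ^ n` vanishes in degrees below `n`, and the geometric series of `J` is a two-sided
inverse. -/
theorem exists_antipode_of_basis (b : Module.Basis ι K H) (deg : ι → ℕ)
    (hΔ : ∀ i, Coalgebra.comul (R := K) (b i) ∈
      Submodule.span K {x | ∃ j k, deg j + deg k = deg i ∧ x = b j ⊗ₜ[K] b k})
    (h0 : ∀ i, deg i = 0 → algebraMap K H (Coalgebra.counit (R := K) (b i)) = b i) :
    ∃ σ : WithConv (H →ₗ[K] H), σ * .toConv .id = 1 ∧ .toConv .id * σ = 1 := by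
  let J : WithConv (H →ₗ[K] H) := 1 - .toConv .id
  have hJ0 : ∀ i, deg i = 0 → J.ofConv (b i) = 0 := by
    intro i hi
    change algebraMap K H (Coalgebra.counit (R := K) (b i)) - b i = 0
    rw [h0 i hi, sub_self]
  have hJ : ∀ n i, deg i < n → (J ^ n).ofConv (b i) = 0 := by
    intro n
    induction n with
    | zero => intro i hi; omega
    | succ n ih =>
      intro i hi
      rw [pow_succ', convMul_congr b deg hΔ J 0 (J ^ n) 0 i, mul_zero]
      · rfl
      · intro j k hjk
        -- Either the left factor has degree zero and is killed by `J`, or the right factor has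
        -- degree less than `n` and is killed by `J ^ n`.
        by_cases hj : deg j = 0
        · rw [hJ0 j hj, zero_mul]
          exact (zero_mul _).symm
        · rw [ih k (by omega), mul_zero]
          exact (zero_mul _).symm
  let G : ℕ → WithConv (H →ₗ[K] H) := fun n => ∑ k ∈ Finset.range (n + 1), J ^ k
  have hG : ∀ n i, deg i ≤ n → (G n).ofConv (b i) = (G (deg i)).ofConv (b i) := by
    intro n i hi
    induction n, hi using Nat.le_induction with
    | base => rfl
    | succ n hn ih =>
      have : G (n + 1) = G n + J ^ (n + 1) := Finset.sum_range_succ _ _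
      rw [this]
      change (G n).ofConv (b i) + (J ^ (n + 1)).ofConv (b i) = _
      rw [hJ _ _ (by omega), add_zero, ih]
  -- On each basis element the series is truncated at its degree; by `hG` any later truncation gives
  -- the same value.
  let σ : WithConv (H →ₗ[K] H) := .toConv (b.constr K fun i => (G (deg i)).ofConv (b i))
  have hσ : ∀ n i, deg i ≤ n → σ.ofConv (b i) = (G n).ofConv (b i) := by
    intro n i hi
    rw [hG n i hi]
    exact b.constr_basis K _ i
  have hid : (.toConv .id : WithConv (H →ₗ[K] H)) = 1 - J := (sub_sub_cancel _ _).symm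
  have hone : ∀ i, (1 - J ^ (deg i + 1)).ofConv (b i) =
      (1 : WithConv (H →ₗ[K] H)).ofConv (b i) := by
    intro i
    change (1 : WithConv (H →ₗ[K] H)).ofConv (b i) - (J ^ (deg i + 1)).ofConv (b i) = _
    rw [hJ _ _ (Nat.lt_succ_self _), sub_zero]
  refine ⟨σ, WithConv.ext (b.ext fun i => ?_), WithConv.ext (b.ext fun i => ?_)⟩
  -- Only degrees at most `deg i` matter, so `σ` may be replaced by one truncation, and the finite
  -- geometric sum telescopes.
  · rw [convMul_congr b deg hΔ σ (G (deg i)) _ (.toConv .id) i, hid, geom_sum_mul_neg, hone]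
    intro j k hjk
    rw [hσ (deg i) j (by omega)]
  · rw [convMul_congr b deg hΔ _ (.toConv .id) σ (G (deg i)) i, hid, mul_neg_geom_sum, hone]
    intro j k hjk
    rw [hσ (deg i) k (by omega)]

end Antipode

/-! ### Degrees of reduced words and the antipode -/

section Degree

variable (K : Type v) [Field K] {O : Operad.{u}} {deg : O.carrier → ℕ}

/-- The degree of a reduced word. -/
def wordDegree (deg : O.carrier → ℕ) (w : O.RWord) : ℕ := (w.word.map deg).sum

theorem wordDegree_mul (w w' : O.RWord) :
    wordDegree deg (w * w') = wordDegree deg w + wordDegree deg w' := by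
  simp [wordDegree, Operad.RWord.word, FreeMonoid.toList_mul]

theorem wordDegree_of (x : O.NonUnit) : wordDegree deg (FreeMonoid.of x) = deg x.1 := by
  simp [wordDegree, Operad.RWord.word, FreeMonoid.toList_of]

theorem wordDegree_rd (h : O.IsGrading deg) (l : List O.carrier) :
    wordDegree deg (O.rd l) = (l.map deg).sum := by
  induction l with
  | nil => rfl
  | cons x l ih =>
    rw [List.map_cons, List.sum_cons, ← ih]
    by_cases hx : x = O.unit
    · rw [hx, rd_unit_cons, (h.eq_zero_iff _).2 rfl, zero_add]
    · rw [rd_cons hx, wordDegree_mul, wordDegree_of]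

theorem eq_one_of_wordDegree_eq_zero (h : O.IsGrading deg) (w : O.RWord)
    (hw : wordDegree deg w = 0) : w = 1 := by
  induction w using FreeMonoid.inductionOn' with
  | one => rfl
  | of_mul x w ih =>
    rw [wordDegree_mul, wordDegree_of] at hw
    exact absurd ((h.eq_zero_iff _).1 (by omega)) x.2

/-- Degrees add up in a factorization and deleting units does not change them; multiplicativity
extends homogeneity from generators to all words. -/
theorem comul_mem_span (hO : O.FinitelyFactorizable) (h : O.IsGrading deg) (w : O.RWord) :
    comul K O (elem K w) ∈ Submodule.span K {x | ∃ a b,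
      wordDegree deg a + wordDegree deg b = wordDegree deg w ∧ x = elem K a ⊗ₜ[K] elem K b} := by
  induction w using FreeMonoid.inductionOn' with
  | one =>
    rw [elem_one, map_one]
    exact Submodule.subset_span ⟨1, 1, rfl, rfl⟩
  | of_mul x w ih =>
    rw [elem_mul, map_mul]
    have hx : comul K O (elem K (FreeMonoid.of x)) ∈ Submodule.span K {z | ∃ a b,
        wordDegree deg a + wordDegree deg b = deg x.1 ∧ z = elem K a ⊗ₜ[K] elem K b} := by
      rw [comul_of K hO]
      refine Submodule.sum_mem _ fun q hq => Submodule.subset_span ⟨_, _, ?_, rfl⟩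
      rw [Set.Finite.mem_toFinset] at hq
      rw [wordDegree_rd h, wordDegree_rd h, ← show _ = x.1 from hq, h.comp, List.map_ofFn,
        List.sum_ofFn]
      simp
    have hm := Submodule.mul_mem_mul hx ih
    rw [Submodule.span_mul_span] at hm
    refine Submodule.span_mono ?_ hm
    rintro _ ⟨_, ⟨a, b, hab, rfl⟩, _, ⟨a', b', hab', rfl⟩, rfl⟩
    refine ⟨a * a', b * b', ?_, ?_⟩
    · rw [wordDegree_mul, wordDegree_mul, wordDegree_mul, wordDegree_of]
      omega
    · simp only [elem_mul, Algebra.TensorProduct.tmul_mul_tmul]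

theorem isHopfAlgebra_of_coalgebra (hO : O.FinitelyFactorizable) (h : O.IsGrading deg)
    (coassoc : (TensorProduct.assoc K _ _ _).toLinearMap ∘ₗ
      (comul K O).toLinearMap.rTensor (NatAlg K O) ∘ₗ (comul K O).toLinearMap =
        (comul K O).toLinearMap.lTensor (NatAlg K O) ∘ₗ (comul K O).toLinearMap)
    (hr : (counit K O).toLinearMap.rTensor (NatAlg K O) ∘ₗ (comul K O).toLinearMap =
      TensorProduct.mk K K (NatAlg K O) 1)
    (hl : (counit K O).toLinearMap.lTensor (NatAlg K O) ∘ₗ (comul K O).toLinearMap =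
      (TensorProduct.mk K (NatAlg K O) K).flip 1) :
    IsHopfAlgebra (comul K O) (counit K O) := by
  refine ⟨coassoc, hr, hl, ?_⟩
  let C : Coalgebra K (NatAlg K O) :=
    { comul := (comul K O).toLinearMap
      counit := (counit K O).toLinearMap
      coassoc := coassoc
      rTensor_counit_comp_comul := hr
      lTensor_counit_comp_comul := hl }
  obtain ⟨σ, h1, h2⟩ := @exists_antipode_of_basis K (NatAlg K O) O.RWord _ _ _ C
    (MonoidAlgebra.basis O.RWord K) (wordDegree deg) (comul_mem_span K hO h) fun w hw => by
      rw [eq_one_of_wordDegree_eq_zero h w hw]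
      change algebraMap K _ (counit K O 1) = 1
      rw [map_one, map_one]
  exact ⟨σ.ofConv, congrArg WithConv.ofConv h1, congrArg WithConv.ofConv h2⟩

end Degree

/-! ### Evaluation of tensors -/

section PairMap

variable {K : Type*} [Field K] {V W X Y : Type*} [AddCommGroup V] [Module K V] [AddCommGroup W]
  [Module K W]

/-- The map sending `v ⊗ w` to the function `(x, y) ↦ F(v)(x) G(w)(y)`. -/
def pairMap (F : V →ₗ[K] X → K) (G : W →ₗ[K] Y → K) : V ⊗[K] W →ₗ[K] (X × Y → K) :=
  TensorProduct.lift (LinearMap.mk₂ K (fun v w p => F v p.1 * G w p.2)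
    (fun v v' w => funext fun p => by simp [add_mul])
    (fun r v w => funext fun p => by simp [mul_assoc])
    (fun v w w' => funext fun p => by simp [mul_add])
    (fun r v w => funext fun p => by simp [mul_left_comm]))

theorem pairMap_tmul (F : V →ₗ[K] X → K) (G : W →ₗ[K] Y → K) (v : V) (w : W) (p : X × Y) :
    pairMap F G (v ⊗ₜ w) p = F v p.1 * G w p.2 := rfl

/-- Expand the tensor over a basis of `V`. For fixed `y`, injectivity of `F` and linear independence
annihilate the values at `y` of the second components, which vanish by injectivity of `G`. As
`pairMap` is again such a coordinate map, the lemma can be iterated for triple tensors. -/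
theorem pairMap_injective {F : V →ₗ[K] X → K} {G : W →ₗ[K] Y → K} (hF : Function.Injective F)
    (hG : Function.Injective G) : Function.Injective (pairMap F G) := by
  classical
  rw [injective_iff_map_eq_zero]
  intro x hx
  let b := Module.Basis.ofVectorSpace K V
  obtain ⟨g, rfl⟩ := (TensorProduct.equivFinsuppOfBasisLeft (N := W) b).symm.surjective x
  rw [TensorProduct.equivFinsuppOfBasisLeft_symm_apply] at hx ⊢
  have hg : ∀ y : Y, Finsupp.linearCombination K b
      (g.mapRange (fun w : W => G w y) (by simp)) = 0 := by
    intro y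
    refine hF (funext fun z => ?_)
    have h := congrFun hx (z, y)
    rw [Finsupp.sum, map_sum] at h
    rw [Finsupp.linearCombination_apply, Finsupp.sum_mapRange_index (by simp), Finsupp.sum, map_sum,
      map_zero]
    simp only [Finset.sum_apply, pairMap_tmul, map_smul, Pi.smul_apply, smul_eq_mul] at h ⊢
    refine Eq.trans (Finset.sum_congr rfl fun i _ => ?_) h
    exact mul_comm _ _
  have : g = 0 := by
    refine Finsupp.ext fun i => hG (funext fun y => ?_)
    rw [Finsupp.zero_apply, map_zero]
    exact DFunLike.congr_fun
      ((linearIndependent_iff.1 b.linearIndependent) _ (hg y)) i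
  rw [this, Finsupp.sum_zero_index]

end PairMap

/-! ### Shuffles of three words -/

section Shuffles

variable {K : Type v} [Field K] {A B C : Type u}

theorem thetaFun_nil_left (f : List (A ⊕ B) → K) (v : List B) :
    thetaFun f [] v = f (v.map Sum.inr) := by
  induction v generalizing f with
  | nil => exact thetaFun_nil_nil f
  | cons b v ih => rw [thetaFun_nil_cons, ih]; rfl

theorem thetaFun_nil_right (f : List (A ⊕ B) → K) (u : List A) :
    thetaFun f u [] = f (u.map Sum.inl) := by
  induction u generalizing f with
  | nil => exact thetaFun_nil_nil f
  | cons a u ih => rw [thetaFun_cons_nil, ih]; rfl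

theorem leftPart_map_sumAssoc (n : List ((A ⊕ B) ⊕ C)) :
    leftPart (n.map (Equiv.sumAssoc A B C)) = leftPart (leftPart n) := by
  induction n with
  | nil => rfl
  | cons x n ih =>
    obtain (a | b) | d := x
    · exact congrArg (a :: ·) ih
    · exact ih
    · exact ih

theorem leftPart_rightPart_map_sumAssoc (n : List ((A ⊕ B) ⊕ C)) :
    leftPart (rightPart (n.map (Equiv.sumAssoc A B C))) = rightPart (leftPart n) := by
  induction n with
  | nil => rfl
  | cons x n ih =>
    obtain (a | b) | d := x
    · exact ih
    · exact congrArg (b :: ·) ih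
    · exact ih

theorem rightPart_rightPart_map_sumAssoc (n : List ((A ⊕ B) ⊕ C)) :
    rightPart (rightPart (n.map (Equiv.sumAssoc A B C))) = rightPart n := by
  induction n with
  | nil => rfl
  | cons x n ih =>
    obtain (a | b) | d := x
    · exact ih
    · exact ih
    · exact congrArg (d :: ·) ih

theorem mem_shuffles_toFinset {u : List A} {v : List B} {w : List (A ⊕ B)} :
    w ∈ (shuffles_finite u v).toFinset ↔ leftPart w = u ∧ rightPart w = v := by
  rw [Set.Finite.mem_toFinset]
  rfl

/-- Both sides sum over the words on three alphabets with prescribed restrictions `u`, `v`, `w`: the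
intermediate word `m` is itself a restriction of the longer word, hence redundant. -/
theorem sum_thetaFun_assoc (F : List ((A ⊕ B) ⊕ C) → K) (G : List (A ⊕ (B ⊕ C)) → K)
    (h : ∀ n, G (n.map (Equiv.sumAssoc A B C)) = F n) (u : List A) (v : List B) (w : List C) :
    thetaFun (fun m => thetaFun F m w) u v = thetaFun (fun m => thetaFun G u m) v w := by
  have hsymm : ∀ n : List (A ⊕ (B ⊕ C)),
      (n.map (Equiv.sumAssoc A B C).symm).map (Equiv.sumAssoc A B C) = n := fun n => by
    rw [List.map_map]
    simp
  simp only [thetaFun]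
  rw [Finset.sum_sigma', Finset.sum_sigma']
  refine Finset.sum_bij'
    (fun p _ => ⟨rightPart (p.2.map (Equiv.sumAssoc A B C)), p.2.map (Equiv.sumAssoc A B C)⟩)
    (fun p _ => ⟨leftPart (p.2.map (Equiv.sumAssoc A B C).symm),
      p.2.map (Equiv.sumAssoc A B C).symm⟩) ?_ ?_ ?_ ?_ ?_
  · rintro ⟨m, n⟩ hp
    simp only [Finset.mem_sigma, mem_shuffles_toFinset] at hp ⊢
    obtain ⟨⟨h1, h2⟩, rfl, h3⟩ := hp
    exact ⟨⟨(leftPart_rightPart_map_sumAssoc n).trans h2,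
      (rightPart_rightPart_map_sumAssoc n).trans h3⟩, (leftPart_map_sumAssoc n).trans h1, trivial⟩
  · rintro ⟨m, n⟩ hp
    simp only [Finset.mem_sigma, mem_shuffles_toFinset] at hp ⊢
    obtain ⟨⟨h1, h2⟩, h3, rfl⟩ := hp
    refine ⟨⟨?_, ?_⟩, trivial, ?_⟩
    · rw [← leftPart_map_sumAssoc, hsymm, h3]
    · rw [← leftPart_rightPart_map_sumAssoc, hsymm, h1]
    · rw [← rightPart_rightPart_map_sumAssoc, hsymm, h2]
  · rintro ⟨m, n⟩ hp
    simp only [Finset.mem_sigma, mem_shuffles_toFinset] at hp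
    obtain ⟨-, rfl, -⟩ := hp
    simp
  · rintro ⟨m, n⟩ hp
    simp only [Finset.mem_sigma, mem_shuffles_toFinset] at hp
    obtain ⟨-, -, rfl⟩ := hp
    simp
  · rintro ⟨m, n⟩ -
    exact (h n).symm

end Shuffles

/-! ### The coalgebra structure -/

section Coalgebra

variable {S : Signature.{u}}

/-- A map preserving and reflecting all relations leaves compatibility unchanged. It is applied to
the inclusions of the two summands and to the reassociation of triple sums. -/
theorem Forest.compatible_map_iff {A B : ForestAlphabet S.carrier} (e : A.carrier → B.carrier)
    (hr : ∀ a, ForestAlphabet.IsRoot B (e a) ↔ ForestAlphabet.IsRoot A a)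
    (hd : ∀ s a, ForestAlphabet.IsDec B s (e a) ↔ ForestAlphabet.IsDec A s a)
    (he : ∀ j a a', ForestAlphabet.IsEdge B j (e a) (e a') ↔ ForestAlphabet.IsEdge A j a a')
    (f : Forest S) (w : List A.carrier) :
    Forest.Compatible f B (w.map e) ↔ Forest.Compatible f A w := by
  constructor
  · intro h
    refine ⟨by simpa using h.length, fun i a hi ha => ?_, fun i a s hs ha => ?_,
      fun j i i' a a' hj ha ha' => ?_⟩
    · exact (hr a).1 (h.root i _ hi (by rw [List.getElem?_map, ha]; rfl))
    · exact (hd s a).1 (h.dec i _ s hs (by rw [List.getElem?_map, ha]; rfl))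
    · exact (he j a a').1 (h.edge j i i' _ _ hj (by rw [List.getElem?_map, ha]; rfl)
        (by rw [List.getElem?_map, ha']; rfl))
  · intro h
    refine ⟨by simpa using h.length, fun i b hi hb => ?_, fun i b s hs hb => ?_,
      fun j i i' b b' hj hb hb' => ?_⟩
    · rw [List.getElem?_map, Option.map_eq_some_iff] at hb
      obtain ⟨a, ha, rfl⟩ := hb
      exact (hr a).2 (h.root i _ hi ha)
    · rw [List.getElem?_map, Option.map_eq_some_iff] at hb
      obtain ⟨a, ha, rfl⟩ := hb
      exact (hd s a).2 (h.dec i _ s hs ha)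
    · rw [List.getElem?_map, Option.map_eq_some_iff] at hb hb'
      obtain ⟨a, ha, rfl⟩ := hb
      obtain ⟨a', ha', rfl⟩ := hb'
      exact (he j a a').2 (h.edge j i i' _ _ hj ha ha')

variable {c : (freeOperad S).Congruence} (hfin : c.FiniteType) (K : Type v) [Field K]

/-- The coefficients of the realization of an element. -/
def realizeCoeff (A : ForestAlphabet S.carrier) :
    NatAlg K c.quotient →ₗ[K] (List A.carrier → K) :=
  (polySubmodule K A.carrier).subtype ∘ₗ (realizeHom hfin K A).toLinearMap

theorem realizeCoeff_elem (A : ForestAlphabet S.carrier) (w : c.quotient.RWord)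
    (m : List A.carrier) :
    realizeCoeff hfin K A (elem K w) m = ∑ f ∈ lifts hfin w.word, (compatibleSum K A f).1 m := by
  have : realizeHom hfin K A (elem K w) = _ := (sum_lifts_compatibleSum hfin K A w.word).symm ▸
    realizeHom_elem hfin K A w
  change (realizeHom hfin K A (elem K w)).1 m = _
  rw [this, AddSubmonoidClass.coe_finsetSum, Finset.sum_apply]

theorem realizeCoeff_map {A B : ForestAlphabet S.carrier} (e : A.carrier → B.carrier)
    (hr : ∀ a, ForestAlphabet.IsRoot B (e a) ↔ ForestAlphabet.IsRoot A a)
    (hd : ∀ s a, ForestAlphabet.IsDec B s (e a) ↔ ForestAlphabet.IsDec A s a)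
    (he : ∀ j a a', ForestAlphabet.IsEdge B j (e a) (e a') ↔ ForestAlphabet.IsEdge A j a a')
    (x : NatAlg K c.quotient) (m : List A.carrier) :
    realizeCoeff hfin K B x (m.map e) = realizeCoeff hfin K A x m := by
  classical
  have : LinearMap.proj (m.map e) ∘ₗ realizeCoeff hfin K B =
      LinearMap.proj m ∘ₗ realizeCoeff hfin K A := by
    refine natAlg_hom_ext K fun w => ?_
    rw [LinearMap.comp_apply, LinearMap.comp_apply, LinearMap.proj_apply, LinearMap.proj_apply,
      realizeCoeff_elem, realizeCoeff_elem]
    exact Finset.sum_congr rfl fun f _ =>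
      if_congr (Forest.compatible_map_iff e hr hd he f m) rfl rfl
  exact LinearMap.congr_fun this x

theorem realizeCoeff_positions_injective :
    Function.Injective (realizeCoeff hfin K (ForestAlphabet.positions S.carrier)) := by
  intro x y h
  have h' : realizeHom hfin K (ForestAlphabet.positions S.carrier) x =
      realizeHom hfin K (ForestAlphabet.positions S.carrier) y := Subtype.ext h
  refine quotientRealize_positions_injective hfin K ?_
  rw [quotientRealize_eq hfin]
  exact h'

/-- A class different from the unit contains no leaf, so its compatible words are nonempty and its
constant term is zero, like its counit. -/
theorem realizeCoeff_nil (A : ForestAlphabet S.carrier) (x : NatAlg K c.quotient) :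
    realizeCoeff hfin K A x [] = counit K c.quotient x := by
  have : LinearMap.proj [] ∘ₗ realizeCoeff hfin K A = (counit K c.quotient).toLinearMap := by
    refine natAlg_hom_ext K fun w => ?_
    change (realizeHom hfin K A (elem K w)).1 [] = counit K c.quotient (elem K w)
    induction w using FreeMonoid.inductionOn' with
    | one =>
      rw [elem_one, map_one, map_one]
      rfl
    | of_mul x w ih =>
      rw [elem_mul, map_mul, map_mul, counit_of, zero_mul, realizeHom_of]
      refine (Poly.conv_nil _ _).trans ?_
      have : (classSum hfin K A x.1).1 [] = 0 := by
        rw [classSum, AddSubmonoidClass.coe_finsetSum, Finset.sum_apply]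
        refine Finset.sum_eq_zero fun t ht => ?_
        rw [mem_fiber] at ht
        cases t with
        | leaf => exact absurd ht.symm x.2
        | node s t => exact termSum_node_nil K A _ s t
      rw [this, zero_mul]
  exact LinearMap.congr_fun this x

theorem toPairs_map (A B : ForestAlphabet S.carrier)
    (T : NatAlg K c.quotient ⊗[K] NatAlg K c.quotient) :
    toPairs K A.carrier B.carrier
      (Algebra.TensorProduct.map (realizeHom hfin K A) (realizeHom hfin K B) T) =
        pairMap (realizeCoeff hfin K A) (realizeCoeff hfin K B) T := by
  induction T using TensorProduct.induction_on with
  | zero => rw [map_zero, map_zero, map_zero]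
  | add T U hT hU => rw [map_add, map_add, map_add, hT, hU]
  | tmul x y => rfl

variable (hdeg : c.DegreeCompatible)

include hdeg in
-- The doubling identity in coefficients; combined with injectivity on the positions, it determines
-- the coproduct.
theorem pairMap_comul (A B : ForestAlphabet S.carrier) (x : NatAlg K c.quotient)
    (u : List A.carrier) (v : List B.carrier) :
    pairMap (realizeCoeff hfin K A) (realizeCoeff hfin K B) (comul K c.quotient x) (u, v) =
      thetaFun (realizeCoeff hfin K (sumAlphabet A B) x) u v := by
  rw [← toPairs_map, ← doubles_realizeHom hfin K hdeg, theta_apply]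
  rfl

include hfin hdeg in
-- Applying the counit on the left amounts to taking the empty word there. Only words entirely on
-- the right summand remain, and this summand has its original relations.
theorem rTensor_counit_comul :
    (counit K c.quotient).toLinearMap.rTensor (NatAlg K c.quotient) ∘ₗ
      (comul K c.quotient).toLinearMap = TensorProduct.mk K K (NatAlg K c.quotient) 1 := by
  let A := ForestAlphabet.positions S.carrier
  refine LinearMap.ext fun x => (TensorProduct.lid K (NatAlg K c.quotient)).injective ?_
  refine realizeCoeff_positions_injective hfin K (funext fun v => ?_)
  have key : ∀ T : NatAlg K c.quotient ⊗[K] NatAlg K c.quotient,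
      realizeCoeff hfin K A (TensorProduct.lid K (NatAlg K c.quotient)
        ((counit K c.quotient).toLinearMap.rTensor (NatAlg K c.quotient) T)) v =
      pairMap (realizeCoeff hfin K A) (realizeCoeff hfin K A) T ([], v) := by
    intro T
    induction T using TensorProduct.induction_on with
    | zero => simp only [map_zero, Pi.zero_apply]
    | add T U hT hU => simp only [map_add, Pi.add_apply, hT, hU]
    | tmul x y =>
      rw [pairMap_tmul, realizeCoeff_nil, LinearMap.rTensor_tmul, TensorProduct.lid_tmul, map_smul]
      rfl
  refine (key _).trans ?_
  refine (pairMap_comul hfin K hdeg A A x [] v).trans ?_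
  rw [thetaFun_nil_left]
  refine (realizeCoeff_map hfin K (A := A) (B := sumAlphabet A A) Sum.inr (fun _ => Iff.rfl)
    (fun _ _ => Iff.rfl) (fun _ _ _ => Iff.rfl) x v).trans ?_
  rw [TensorProduct.mk_apply, TensorProduct.lid_tmul, one_smul]

include hfin hdeg in
theorem lTensor_counit_comul :
    (counit K c.quotient).toLinearMap.lTensor (NatAlg K c.quotient) ∘ₗ
      (comul K c.quotient).toLinearMap = (TensorProduct.mk K (NatAlg K c.quotient) K).flip 1 := by
  let A := ForestAlphabet.positions S.carrier
  refine LinearMap.ext fun x => (TensorProduct.rid K (NatAlg K c.quotient)).injective ?_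
  refine realizeCoeff_positions_injective hfin K (funext fun u => ?_)
  have key : ∀ T : NatAlg K c.quotient ⊗[K] NatAlg K c.quotient,
      realizeCoeff hfin K A (TensorProduct.rid K (NatAlg K c.quotient)
        ((counit K c.quotient).toLinearMap.lTensor (NatAlg K c.quotient) T)) u =
      pairMap (realizeCoeff hfin K A) (realizeCoeff hfin K A) T (u, []) := by
    intro T
    induction T using TensorProduct.induction_on with
    | zero => simp only [map_zero, Pi.zero_apply]
    | add T U hT hU => simp only [map_add, Pi.add_apply, hT, hU]
    | tmul x y =>
      rw [pairMap_tmul, realizeCoeff_nil, LinearMap.lTensor_tmul, TensorProduct.rid_tmul, map_smul,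
        mul_comm]
      rfl
  refine (key _).trans ?_
  refine (pairMap_comul hfin K hdeg A A x u []).trans ?_
  rw [thetaFun_nil_right]
  refine (realizeCoeff_map hfin K (A := A) (B := sumAlphabet A A) Sum.inl (fun _ => Iff.rfl)
    (fun _ _ => Iff.rfl) (fun _ _ _ => Iff.rfl) x u).trans ?_
  rw [LinearMap.flip_apply, TensorProduct.mk_apply, TensorProduct.rid_tmul, one_smul]

theorem sumRel_assoc (A B C : ForestAlphabet S.carrier) (r : ForestSymbol S.carrier)
    (x : Fin ((forestSignature S.carrier).arity r) → (A.carrier ⊕ B.carrier) ⊕ C.carrier) :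
    (sumAlphabet (sumAlphabet A B) C).rel r x ↔
      (sumAlphabet A (sumAlphabet B C)).rel r (fun i => Equiv.sumAssoc _ _ _ (x i)) := by
  cases r with
  | root =>
    change Sum.elim _ _ (x 0) ↔ Sum.elim _ _ (Equiv.sumAssoc _ _ _ (x 0))
    obtain (a | b) | d := x 0 <;> exact Iff.rfl
  | dec s =>
    change Sum.elim _ _ (x 0) ↔ Sum.elim _ _ (Equiv.sumAssoc _ _ _ (x 0))
    obtain (a | b) | d := x 0 <;> exact Iff.rfl
  | edge j =>
    simp only [ForestAlphabet.sumRel]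
    generalize x 0 = y
    generalize x 1 = z
    obtain (a | b) | d := y <;> obtain (a' | b') | d' := z <;> exact Iff.rfl

include hfin hdeg in
-- The coefficients of both iterated coproducts at `(u, v, w)` are sums over shuffles of the
-- coefficients of the realization on a triple sum of alphabets, and the two bracketings of that sum
-- are isomorphic.
theorem comul_coassoc :
    (TensorProduct.assoc K _ _ _).toLinearMap ∘ₗ
      (comul K c.quotient).toLinearMap.rTensor (NatAlg K c.quotient) ∘ₗ
        (comul K c.quotient).toLinearMap =
      (comul K c.quotient).toLinearMap.lTensor (NatAlg K c.quotient) ∘ₗ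
        (comul K c.quotient).toLinearMap := by
  let A := ForestAlphabet.positions S.carrier
  let R := realizeCoeff hfin K A
  let R₂ := realizeCoeff hfin K (sumAlphabet A A)
  have hR : Function.Injective R := realizeCoeff_positions_injective hfin K
  refine LinearMap.ext fun x => pairMap_injective hR (pairMap_injective hR hR)
    (funext fun ⟨u, v, w⟩ => ?_)
  have hl : ∀ T : NatAlg K c.quotient ⊗[K] NatAlg K c.quotient,
      pairMap R (pairMap R R) (TensorProduct.assoc K _ _ _
        ((comul K c.quotient).toLinearMap.rTensor (NatAlg K c.quotient) T)) (u, v, w) =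
      thetaFun (fun m => pairMap R₂ R T (m, w)) u v := by
    intro T
    induction T using TensorProduct.induction_on with
    | zero =>
      simp only [map_zero, Pi.zero_apply]
      exact (thetaFun_zero u v).symm
    | add T U hT hU =>
      simp only [map_add, Pi.add_apply, hT, hU]
      exact (thetaFun_add _ _ u v).symm
    | tmul x y =>
      have h1 : ∀ U : NatAlg K c.quotient ⊗[K] NatAlg K c.quotient,
          pairMap R (pairMap R R) (TensorProduct.assoc K _ _ _ (U ⊗ₜ[K] y)) (u, v, w) =
            pairMap R R U (u, v) * R y w := by
        intro U
        induction U using TensorProduct.induction_on with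
        | zero => simp only [TensorProduct.zero_tmul, map_zero, Pi.zero_apply, zero_mul]
        | add U U' hU hU' => simp only [TensorProduct.add_tmul, map_add, Pi.add_apply, hU, hU', add_mul]
        | tmul a b =>
          rw [TensorProduct.assoc_tmul, pairMap_tmul, pairMap_tmul, pairMap_tmul, mul_assoc]
      rw [LinearMap.rTensor_tmul, h1]
      refine (congrArg (· * R y w) (pairMap_comul hfin K hdeg A A x u v)).trans ?_
      rw [mul_comm, ← thetaFun_mul_left]
      refine congrArg (fun f => thetaFun f u v) (funext fun m => ?_)
      rw [pairMap_tmul, mul_comm]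
  have hr : ∀ T : NatAlg K c.quotient ⊗[K] NatAlg K c.quotient,
      pairMap R (pairMap R R)
        ((comul K c.quotient).toLinearMap.lTensor (NatAlg K c.quotient) T) (u, v, w) =
      thetaFun (fun m => pairMap R R₂ T (u, m)) v w := by
    intro T
    induction T using TensorProduct.induction_on with
    | zero =>
      simp only [map_zero, Pi.zero_apply]
      exact (thetaFun_zero v w).symm
    | add T U hT hU =>
      simp only [map_add, Pi.add_apply, hT, hU]
      exact (thetaFun_add _ _ v w).symm
    | tmul x y =>
      rw [LinearMap.lTensor_tmul, pairMap_tmul]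
      refine (congrArg (R x u * ·) (pairMap_comul hfin K hdeg A A y v w)).trans ?_
      exact (thetaFun_mul_left _ _ v w).symm
  refine (hl _).trans (Eq.trans ?_ (hr _).symm)
  -- The remaining coproduct is removed by doubling with one summand already a sum, which leads to
  -- the two bracketings of the triple sum.
  have e1 : ∀ m, pairMap R₂ R (comul K c.quotient x) (m, w) = _ := fun m =>
    pairMap_comul hfin K hdeg (sumAlphabet A A) A x m w
  have e2 : ∀ m, pairMap R R₂ (comul K c.quotient x) (u, m) = _ := fun m =>
    pairMap_comul hfin K hdeg A (sumAlphabet A A) x u m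
  refine (congrArg (fun f => thetaFun f u v) (funext e1)).trans (Eq.trans ?_
    (congrArg (fun f => thetaFun f v w) (funext e2)).symm)
  refine sum_thetaFun_assoc _ _ (fun n => ?_) u v w
  have hrel := sumRel_assoc A A A
  refine realizeCoeff_map hfin K (A := sumAlphabet (sumAlphabet A A) A)
    (B := sumAlphabet A (sumAlphabet A A)) (Equiv.sumAssoc _ _ _) (fun a => ?_) (fun s a => ?_)
    (fun j a a' => ?_) x n
  · exact (hrel .root ![a]).symm
  · exact (hrel (.dec s) ![a]).symm
  · exact (hrel (.edge j) ![a, a']).symm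

end Coalgebra

end NatHopf

end

/-! ### Assembly of the polynomial realization -/

theorem mainTheorem3 {K : Type v} [Field K] [CharZero K] (S : Signature.{u})
    (c : (freeOperad S).Congruence) (hdeg : c.DegreeCompatible) (hfin : c.FiniteType) :
    c.quotient.FinitelyFactorizable ∧
    c.quotient.IsGrading (c.quotDegree hdeg) ∧
    IsHopfAlgebra (comul K c.quotient) (counit K c.quotient) ∧
    IsPolynomialRealization (natGrading K (c.quotDegree hdeg)) (comul K c.quotient)
      (Set.univ : Set (ForestAlphabet S.carrier)) (ForestAlphabet.sumRel S.carrier)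
      (fun A => quotientRealize K c A) (ForestAlphabet.positions S.carrier) := by
  have hF := quotient_finitelyFactorizable hfin
  have hG := quotient_isGrading c hdeg
  refine ⟨hF, hG, isHopfAlgebra_of_coalgebra K hF hG (comul_coassoc hfin K hdeg)
    (rTensor_counit_comul hfin K hdeg) (lTensor_counit_comul hfin K hdeg), ?_⟩
  refine
    { positive := fun r => by cases r <;> simp
      sum_mem := fun _ _ _ _ => trivial
      sum_assoc := fun A _ B _ C _ r x => sumRel_assoc A B C r x
      map_one := fun A _ => ?_
      map_mul := fun A _ x y => ?_
      graded := fun A _ n x hx => ?_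
      doubling := fun A _ B _ x => ?_
      mem := trivial
      injective := quotientRealize_positions_injective hfin K }
  · rw [quotientRealize_eq hfin]
    exact map_one (realizeHom hfin K A)
  · rw [quotientRealize_eq hfin]
    exact map_mul (realizeHom hfin K A) x y
  · refine Submodule.span_le (p := (polyGrading K A.carrier n).comap (quotientRealize K c A)).2
      ?_ hx
    rintro _ ⟨w, hw, rfl⟩
    change quotientRealize K c A (elem K w) ∈ polyGrading K A.carrier n
    rw [quotientRealize_elem hfin]
    -- A word compatible with a lift `f` has the degree of `f` as length, and this equals the degree
    -- of `w` because the degree of a class is computed on any of its terms.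
    refine Submodule.sum_mem _ fun f hf m hm => if_neg fun h => hm ?_
    rw [mem_lifts] at hf
    rw [h.length, ← hw, ← hf, List.map_map]
    rfl
  · simp only [quotientRealize_eq hfin]
    exact doubles_realizeHom hfin K hdeg A B x
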